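/- Setting. There are $n$ bidders and $m$ items. Bidder $i$'s type $t_i=(t_{ij})_{j\in[m]}$ has independent coordinates $t_{ij}\sim D_{ij}$, types are independent across bidders, $D_i=\prod_j D_{ij}$, $D=\prod_i D_i$. The valuations $v_i(t_i,\cdot):2^{[m]}\to\mathbb R_{\ge0}$ are normalized ($v_i(t_i,\emptyset)=0$), monotone, subadditive, and without externalities ($v_i(t_i,S)$ depends only on $(t_{ij})_{j\in S}$), and measurable in $t_i$; $V_i(t_{ij})=v_i(t_i,\{j\})$. Mechanisms. In an anonymous sequential posted price mechanism with entry fee (ASPE) with item prices $p_j\ge 0$ and entry fee functions $\delta_i:2^{[m]}\to\mathbb R_{\ge0}$, the bidders are visited in the order $1,\dots,n$. Bidder $i$ sees the set $S_i(t_{<i})$ of unsold items, accepts the fee $\delta_i(S_i(t_{<i}))$ if and only if $\max_{S\subseteq S_i(t_{<i})}(v_i(t_i,S)-\sum_{j\in S}p_j)\ge\delta_i(S_i(t_{<i}))$, and in that case pays the fee, takes a bundle attaining this maximum and pays its prices. In a rationed sequential posted price mechanism (RSPM) with prices $p_{ij}\ge0$, each bidder in turn buys a favourite bundle with at most one item,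 without an entry fee. Ties between favourite bundles are broken by an arbitrary fixed rule. $\mathrm{APostEnRev}$ and $\mathrm{PostRev}$ are the suprema, in $[0,\infty]$, of the expected revenues of ASPEs and of RSPMs. Parameters. Let $b\in(0,1)$, let $X$ be any feasible randomized allocation rule (no item goes to two bidders), and let $\sigma_{iS}(t_i)$ be the interim probability that bidder $i$ with type $t_i$ receives exactly $S$. Let $\beta_{ij}\ge0$ satisfy, for all $i,j$, (i) $\sum_{k\ne i}\Pr[V_k(t_{kj})\ge\beta_{kj}]\le b$ and (ii) $\mathbb E_{t_i}[\sum_{S\ni j}\sigma_{iS}(t_i)]\le\Pr[V_i(t_{ij})\ge\beta_{ij}]/b$. Put $c_i=\inf\{x\ge0:\sum_j\Pr[V_i(t_{ij})\ge\beta_{ij}+x]\le\frac12\}$ and $v'_i(t_i,S)=v_i(t_i,\{j\in S:V_i(t_{ij})<\beta_{ij}+c_i\})$. Let $\alpha\ge1$ and, for all $i,t_i,S$, let $(\gamma^S_j(t_i))_{j\in S}$ be nonnegative $\alpha$-supporting prices for $v'_i(t_i,\cdot)$ and $S$, measurable in $t_i$; that is, $\sum_{j\in S'}\gamma^S_j(t_i)\le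 v'_i(t_i,S')$ for all $S'\subseteq S$, and $\sum_{j\in S}\gamma_j^S(t_i)\ge v'_i(t_i,S)/\alpha$. Define $$Q_j=\tfrac12\sum_i\mathbb E_{t_i}\Big[\sum_{S\ni j}\sigma_{iS}(t_i)\gamma_j^S(t_i)\Big],\qquad \tau_i=\inf\Big\{x\ge0:\sum_j\Pr[V_i(t_{ij})\ge\max\{\beta_{ij},Q_j+x\}]\le\tfrac12\Big\},$$ $$\mu_i(t_i,S)=\max_{S'\subseteq S}\Big(v_i\big(t_i,\{j\in S':V_i(t_{ij})<Q_j+\tau_i\}\big)-\sum_{j\in S'}Q_j\Big),\quad \delta_i(S)=\inf\{a\ge0:\Pr_{t_i}[\mu_i(t_i,S)\le a]\ge\tfrac12\}.$$ Claim. (1) In the ASPE with item prices $Q_j$ and entry fees $\delta_i$, for all $i$ and $t_{<i}$, bidder $i$ accepts the entry fee $\delta_i(S_i(t_{<i}))$ with probability at least $1/2$ over $t_i\sim D_i$. (2) $$\mathrm{APostEnRev}\ \ge\ \frac14\sum_jQ_j-\left(\frac5{2(1-b)}+\frac{b+1}{2b(1-b)}\right)\mathrm{PostRev}.$$ The same lower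 bound holds for the supremum of the revenues of the ASPEs whose item prices are exactly the $Q_j$; and it holds for the revenue of the ASPE with item prices $Q_j$ and entry fees $\delta_i$ themselves whenever $\sum_j\Pr[V_i(t_{ij})\ge\max\{\beta_{ij},Q_j+\tau_i\}]\le\frac12$ for every $i$ (which is automatic if the distributions of the $V_i(t_{ij})$ have no atoms). (If $\mathrm{PostRev}=\infty$ the bounds are void.) -/

import Mathlib

open MeasureTheory
open scoped ENNReal NNReal

noncomputable section

namespace Auction

universe u

/-- The type of bidder `i` is a vector `t_i = (t_{ij})_j`, one entry for each item. -/
abbrev BidderType {n m : ℕ} (T : Fin n → Fin m → Type u) (i : Fin n) : Type u :=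
  ∀ j : Fin m, T i j

/-- A type profile `t = (t_i)_i`. -/
abbrev Profile {n m : ℕ} (T : Fin n → Fin m → Type u) : Type u :=
  ∀ i : Fin n, BidderType T i

/-- `v i t_i S` is the value of bidder `i` with type `t_i` for the set `S` of items. -/
abbrev Valuation {n m : ℕ} (T : Fin n → Fin m → Type u) : Type u :=
  ∀ i : Fin n, BidderType T i → Finset (Fin m) → ℝ

section Environment

variable {n m : ℕ} {T : Fin n → Fin m → Type u} [∀ i j, MeasurableSpace (T i j)]

/-- `D_i = ∏_j D_{ij}`. -/
def bidderDist (D : ∀ i j, Measure (T i j)) (i : Fin n) : Measure (BidderType T i) :=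
  Measure.pi (D i)

/-- `D = ∏_i D_i`. -/
def profileDist (D : ∀ i j, Measure (T i j)) [∀ i j, IsProbabilityMeasure (D i j)] :
    Measure (Profile T) :=
  Measure.pi (fun i => Measure.pi (D i))

/-- Valuations that are subadditive over independent items: every `v_i(t_i, ·)` is normalized,
monotone and subadditive, and there are no externalities. -/
structure SubadditiveOverItems (v : Valuation T) : Prop where
  measurable : ∀ i S, Measurable (fun t => v i t S)
  empty : ∀ i t, v i t ∅ = 0
  mono : ∀ i t (U W : Finset (Fin m)), U ⊆ W → v i t U ≤ v i t W
  subadditive : ∀ i t (U W : Finset (Fin m)), v i t (U ∪ W) ≤ v i t U + v i t W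
  noExternalities : ∀ i (t t' : BidderType T i) (S : Finset (Fin m)),
    (∀ j ∈ S, t j = t' j) → v i t S = v i t' S

/-- `Pr[V_i(t_{ij}) ≥ x]`, where `V_i(t_{ij}) = v_i(t_i, {j})`. -/
def tailProb (D : ∀ i j, Measure (T i j)) (v : Valuation T) (i : Fin n) (j : Fin m) (x : ℝ) : ℝ :=
  (bidderDist D i).real {t | x ≤ v i t {j}}

/-- Nonnegative `α`-supporting prices for the set function `w` and the set `S`. -/
structure IsSupportingPrices (α : ℝ) (w : Finset (Fin m) → ℝ) (S : Finset (Fin m))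
    (p : Fin m → ℝ) : Prop where
  nonneg : ∀ j ∈ S, 0 ≤ p j
  le_value : ∀ S' ⊆ S, ∑ j ∈ S', p j ≤ w S'
  value_le : w S / α ≤ ∑ j ∈ S, p j

/-- The (randomized) allocation rule of a direct mechanism: `prob t a` is the probability that,
on the reported profile `t`, every bidder `i` receives exactly the set `a i`. No item is given to
two bidders. -/
structure AllocationRule (T : Fin n → Fin m → Type u) [∀ i j, MeasurableSpace (T i j)] where
  prob : Profile T → (Fin n → Finset (Fin m)) → ℝ
  measurable : ∀ a, Measurable (fun t => prob t a)
  nonneg : ∀ t a, 0 ≤ prob t a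
  sum_eq_one : ∀ t, ∑ a, prob t a = 1
  feasible : ∀ t a, prob t a ≠ 0 → ∀ i k, i ≠ k → Disjoint (a i) (a k)

/-- `σ_{iS}(t_i)`: the probability, over the types of the others and the randomness of the
mechanism, that bidder `i` receives exactly `S` when reporting `t_i`. -/
def AllocationRule.interim (X : AllocationRule T) (D : ∀ i j, Measure (T i j))
    [∀ i j, IsProbabilityMeasure (D i j)]
    (i : Fin n) (S : Finset (Fin m)) (ti : BidderType T i) : ℝ :=
  ∫ t, ∑ a : Fin n → Finset (Fin m) with a i = S, X.prob (Function.update t i ti) a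
    ∂(profileDist D)

/-- `π_{ij}(t_i) = ∑_{S ∋ j} σ_{iS}(t_i)`. -/
def AllocationRule.itemInterim (X : AllocationRule T) (D : ∀ i j, Measure (T i j))
    [∀ i j, IsProbabilityMeasure (D i j)] (i : Fin n) (j : Fin m) (ti : BidderType T i) : ℝ :=
  ∑ S : Finset (Fin m) with j ∈ S, X.interim D i S ti

/-- `c_i = inf {x ≥ 0 : ∑_j Pr[V_i(t_{ij}) ≥ β_{ij} + x] ≤ 1/2}`. -/
def coreCutoff (D : ∀ i j, Measure (T i j)) (v : Valuation T) (β : Fin n → Fin m → ℝ)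
    (i : Fin n) : ℝ :=
  sInf {x | 0 ≤ x ∧ ∑ j, tailProb D v i j (β i j + x) ≤ 1 / 2}

open scoped Classical in
/-- `w(t_i, S) = v_i(t_i, S ∩ {j : V_i(t_{ij}) < x_j})`. -/
def truncate (v : Valuation T) (i : Fin n) (x : Fin m → ℝ) (ti : BidderType T i)
    (S : Finset (Fin m)) : ℝ :=
  v i ti (S.filter (fun j => v i ti {j} < x j))

/-- `Q_j = (1/2) ∑_i E_{t_i} [∑_{S ∋ j} σ_{iS}(t_i) γ_j^S(t_i)]`. -/
def itemPrice (D : ∀ i j, Measure (T i j)) [∀ i j, IsProbabilityMeasure (D i j)]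
    (X : AllocationRule T)
    (γ : ∀ i : Fin n, BidderType T i → Finset (Fin m) → Fin m → ℝ) (j : Fin m) : ℝ :=
  1 / 2 * ∑ i, ∫ ti, ∑ S : Finset (Fin m) with j ∈ S, X.interim D i S ti * γ i ti S j
    ∂(bidderDist D i)

/-- `τ_i = inf {x ≥ 0 : ∑_j Pr[V_i(t_{ij}) ≥ max {β_{ij}, Q_j + x}] ≤ 1/2}`. -/
def feeCutoff (D : ∀ i j, Measure (T i j)) (v : Valuation T) (β : Fin n → Fin m → ℝ)
    (Q : Fin m → ℝ) (i : Fin n) : ℝ :=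
  sInf {x | 0 ≤ x ∧ ∑ j, tailProb D v i j (max (β i j) (Q j + x)) ≤ 1 / 2}

/-- `Median[h] = inf {a ≥ 0 : Pr[h ≤ a] ≥ 1/2}`. -/
def median {Ω : Type*} [MeasurableSpace Ω] (P : Measure Ω) (h : Ω → ℝ) : ℝ :=
  sInf {a | 0 ≤ a ∧ 1 / 2 ≤ P.real {x | h x ≤ a}}

end Environment

section Mechanisms

variable {n m : ℕ}

/-- Value minus total price of the bundle `S`. -/
def surplus (w : Finset (Fin m) → ℝ) (p : Fin m → ℝ) (S : Finset (Fin m)) : ℝ :=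
  w S - ∑ j ∈ S, p j

/-- `max_{S ⊆ A} (w(S) - ∑_{j ∈ S} p_j)`. -/
def maxSurplus (w : Finset (Fin m) → ℝ) (p : Fin m → ℝ) (A : Finset (Fin m)) : ℝ :=
  A.powerset.sup' (Finset.powerset_nonempty A) (surplus w p)

open scoped Classical in
/-- The bundles of largest surplus among those in the menu `F`. -/
def favourites (w : Finset (Fin m) → ℝ) (p : Fin m → ℝ) (F : Finset (Finset (Fin m))) :
    Finset (Finset (Fin m)) :=
  F.filter (fun S => ∀ S' ∈ F, surplus w p S' ≤ surplus w p S)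

/-- A rule by which each bidder selects one bundle from a nonempty set of favourite bundles. -/
structure TieBreaking (n m : ℕ) where
  pick : Fin n → Finset (Finset (Fin m)) → Finset (Fin m)
  pick_mem : ∀ i F, F.Nonempty → pick i F ∈ F

variable {T : Fin n → Fin m → Type u} [∀ i j, MeasurableSpace (T i j)]

/-- The items left after the first `k` bidders have been visited, in the order `0, 1, …`, when
bidder `i` with type `t_i` who is offered the set `A` buys `buy i t_i A`. -/
def remaining (buy : ∀ i : Fin n, BidderType T i → Finset (Fin m) → Finset (Fin m))
    (t : Profile T) : ℕ → Finset (Fin m)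
  | 0 => Finset.univ
  | k + 1 =>
    if h : k < n then
      remaining buy t k \ buy ⟨k, h⟩ (t ⟨k, h⟩) (remaining buy t k)
    else remaining buy t k

/-- In the anonymous sequential posted price mechanism with item prices `p` and entry fee
functions `δ i`, bidder `i` who is offered `A` accepts the entry fee `δ i A` if and only if her
best surplus from `A` is at least the fee. -/
def aspeAccepts (v : Valuation T) (p : Fin m → ℝ) (δ : Fin n → Finset (Fin m) → ℝ)
    (i : Fin n) (ti : BidderType T i) (A : Finset (Fin m)) : Prop :=
  δ i A ≤ maxSurplus (v i ti) p A

open scoped Classical in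
/-- After accepting, the bidder buys a favourite bundle; otherwise she buys nothing. -/
def aspeBuy (tb : TieBreaking n m) (v : Valuation T) (p : Fin m → ℝ)
    (δ : Fin n → Finset (Fin m) → ℝ) (i : Fin n) (ti : BidderType T i) (A : Finset (Fin m)) :
    Finset (Fin m) :=
  if aspeAccepts v p δ i ti A then tb.pick i (favourites (v i ti) p A.powerset) else ∅

/-- `S_i(t_{<i})`: the items still available when bidder `i` is visited. -/
def aspeAvailable (tb : TieBreaking n m) (v : Valuation T) (p : Fin m → ℝ)
    (δ : Fin n → Finset (Fin m) → ℝ) (t : Profile T) (i : Fin n) : Finset (Fin m) :=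
  remaining (aspeBuy tb v p δ) t i

open scoped Classical in
/-- What bidder `i` pays: the entry fee (if accepted) and the prices of the purchased items. -/
def aspePayment (tb : TieBreaking n m) (v : Valuation T) (p : Fin m → ℝ)
    (δ : Fin n → Finset (Fin m) → ℝ) (t : Profile T) (i : Fin n) : ℝ :=
  (if aspeAccepts v p δ i (t i) (aspeAvailable tb v p δ t i)
    then δ i (aspeAvailable tb v p δ t i) else 0) +
  ∑ j ∈ aspeBuy tb v p δ i (t i) (aspeAvailable tb v p δ t i), p j

/-- The expected revenue of the mechanism with item prices `p` and entry fees `δ`. -/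
def aspeRevenue (D : ∀ i j, Measure (T i j)) [∀ i j, IsProbabilityMeasure (D i j)]
    (tb : TieBreaking n m) (v : Valuation T) (p : Fin m → ℝ)
    (δ : Fin n → Finset (Fin m) → ℝ) : ℝ≥0∞ :=
  ∫⁻ t, ENNReal.ofReal (∑ i, aspePayment tb v p δ t i) ∂(profileDist D)

/-- The best revenue of a mechanism of this kind whose item prices are `p`. -/
def aspeRevenueAtPrices (D : ∀ i j, Measure (T i j)) [∀ i j, IsProbabilityMeasure (D i j)]
    (tb : TieBreaking n m) (v : Valuation T) (p : Fin m → ℝ) : ℝ≥0∞ :=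
  ⨆ δ : Fin n → Finset (Fin m) → ℝ≥0, aspeRevenue D tb v p (fun i S => (δ i S : ℝ))

/-- `APostEnRev`: the best revenue of an anonymous sequential posted price mechanism with entry
fees. -/
def APostEnRev (D : ∀ i j, Measure (T i j)) [∀ i j, IsProbabilityMeasure (D i j)]
    (tb : TieBreaking n m) (v : Valuation T) : ℝ≥0∞ :=
  ⨆ p : Fin m → ℝ≥0, aspeRevenueAtPrices D tb v (fun j => (p j : ℝ))

/-- In a rationed sequential posted price mechanism bidder `i` faces the prices `P i` and buys at
most one item: a favourite one among the bundles with at most one element. -/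
def rspmBuy (tb : TieBreaking n m) (v : Valuation T) (P : Fin n → Fin m → ℝ)
    (i : Fin n) (ti : BidderType T i) (A : Finset (Fin m)) : Finset (Fin m) :=
  tb.pick i (favourites (v i ti) (P i) (A.powerset.filter (fun S => S.card ≤ 1)))

/-- The expected revenue of a rationed sequential posted price mechanism. -/
def rspmRevenue (D : ∀ i j, Measure (T i j)) [∀ i j, IsProbabilityMeasure (D i j)]
    (tb : TieBreaking n m) (v : Valuation T) (P : Fin n → Fin m → ℝ) : ℝ≥0∞ :=
  ∫⁻ t, ENNReal.ofReal
    (∑ i : Fin n, ∑ j ∈ rspmBuy tb v P i (t i) (remaining (rspmBuy tb v P) t i), P i j)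
    ∂(profileDist D)

/-- `PostRev`: the best revenue of a rationed sequential posted price mechanism. -/
def PostRev (D : ∀ i j, Measure (T i j)) [∀ i j, IsProbabilityMeasure (D i j)]
    (tb : TieBreaking n m) (v : Valuation T) : ℝ≥0∞ :=
  ⨆ P : Fin n → Fin m → ℝ≥0, rspmRevenue D tb v (fun i j => (P i j : ℝ))

/-- The entry fee of bidder `i` for the set `S`: the median over `t_i` of
`μ_i(t_i, S) = max_{S' ⊆ S} (v_i(t_i, S' ∩ Y_i(t_i)) - ∑_{j ∈ S'} Q_j)`, where
`Y_i(t_i) = {j : V_i(t_{ij}) < Q_j + τ_i}`. -/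
def medianFee (D : ∀ i j, Measure (T i j)) (v : Valuation T) (Q : Fin m → ℝ) (τ : Fin n → ℝ)
    (i : Fin n) (S : Finset (Fin m)) : ℝ :=
  median (bidderDist D i)
    (fun ti => maxSurplus (truncate v i (fun j => Q j + τ i) ti) Q S)

end Mechanisms

end Auction

end

/-!
The revenue of the mechanism with item prices `Q j` and entry fees is compared with the value that
the allocation rule `X` generates through the supporting prices `γ`.

*Revenue of the mechanism* (`le_aspeRevenue`). Each entry fee is the median of the truncated surplus
`μ i`, so it is accepted with probability at least `1 / 2`, independently of the set of available
items. This surplus is subadditive over independent items and `τ i`-Lipschitz. A two-point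
concentration inequality of Talagrand (`two_point_concentration`), proved by induction on the number
of coordinates, therefore bounds its mean by `2 * median + 2 * τ i`
(`integral_le_two_mul_median_add`). On the other hand, drawing a bundle `S` from the interim
allocation shows that the mean of `μ i` on the available set is at least the expected sum, over the
available items of `S`, of the positive parts of `γ_j - Q j`
(`sum_interimExpectation_netGain_le`). Since the prices `γ_j` are worth `2 Q j` in total and `X`
allocates `j` at most once, every unsold item contributes at least `Q j` minus a discarded part to
the surpluses, and every sold item pays `Q j`.

*Losses.* The loss terms are the sum of the cutoffs `τ i` and the supporting prices of the items
with value at least `Q j + τ i`. Both are charged to rationed posted price mechanisms. When the tail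
probabilities at the prices `P i j` sum up to at most `b` over competing bidders, every item is
available to every bidder with probability at least `1 - b`. If they sum up to at most `1 / 2` over
items, the revenue is at least `(1 - b) / 2 * ∑ P i j * Pr[V_{ij} ≥ P i j]`
(`sum_price_mul_tailProb_le`); if they sum up to at least `1 / 2` and all prices of bidder `i` are
at least `r i`, it is at least `(1 - b) / 4 * ∑ r i` (`sum_le_of_half_le_sum_tailProb`), which
applies to both kinds of cutoffs, `c i` and `τ i`. The prices are lowered by a vanishing amount, so
that the tie-breaking rule does not matter.

*Atoms.* The tail probabilities at `max (β i j) (Q j + τ i)` may sum up to more than `1 / 2`.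
They do not for any level above `τ i`, and the bounds on the suprema follow by letting the level
decrease to `τ i`.
-/

namespace Auction

/-! ### A two-point concentration inequality on product spaces -/

/-- The one-dimensional inequality behind `two_point_concentration`. After normalizing to
`u = (f / p + g / q) / 2 ∈ [0, 1]` and `J = p q I`, the hypotheses say `J ≤ 2` and `u J ≤ 1`, so
that `J ≤ 3 - 2 u`; and `(3 - 2 x) x ^ 2 ≤ 1` on `[0, 1]` for the mean `x` of `u`. -/
theorem integral_mul_integral_mul_integral_le_one {Ω : Type*} [MeasurableSpace Ω]
    (P : Measure Ω) [IsProbabilityMeasure P] {f g I : Ω → ℝ} {p q : ℝ}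
    (hf : Integrable f P) (hg : Integrable g P) (hI : Integrable I P)
    (hp : 0 ≤ p) (hq : 0 ≤ q)
    (hf0 : ∀ x, 0 ≤ f x) (hg0 : ∀ x, 0 ≤ g x)
    (hfp : ∀ᵐ x ∂P, f x ≤ p) (hgq : ∀ᵐ x ∂P, g x ≤ q)
    (h₀ : ∀ x, p * q * I x ≤ 2) (h₁ : ∀ x, f x * q * I x ≤ 1) (h₂ : ∀ x, p * g x * I x ≤ 1) :
    (∫ x, f x ∂P) * (∫ x, g x ∂P) * (∫ x, I x ∂P) ≤ 1 := by
  have hfi : ∫ x, f x ∂P ≤ p := by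
    simpa using integral_mono_ae hf (integrable_const p) hfp
  have hgi : ∫ x, g x ∂P ≤ q := by
    simpa using integral_mono_ae hg (integrable_const q) hgq
  have hfi0 : 0 ≤ ∫ x, f x ∂P := integral_nonneg hf0
  have hgi0 : 0 ≤ ∫ x, g x ∂P := integral_nonneg hg0
  rcases hp.eq_or_lt with rfl | hp
  · simp [le_antisymm hfi hfi0]
  rcases hq.eq_or_lt with rfl | hq
  · simp [le_antisymm hgi hgi0]
  have key : ∀ᵐ x ∂P, p * q * I x ≤ 3 - (f x / p + g x / q) := by
    filter_upwards [hfp, hgq] with x hx hy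
    have ha : f x / p ≤ 1 := (div_le_one hp).2 hx
    have hb : g x / q ≤ 1 := (div_le_one hq).2 hy
    have ha0 : 0 ≤ f x / p := div_nonneg (hf0 x) hp.le
    have hb0 : 0 ≤ g x / q := div_nonneg (hg0 x) hq.le
    have e1 : f x / p * (p * q * I x) ≤ 1 := by
      have : f x / p * (p * q * I x) = f x * q * I x := by field_simp
      rw [this]; exact h₁ x
    have e2 : g x / q * (p * q * I x) ≤ 1 := by
      have : g x / q * (p * q * I x) = p * g x * I x := by field_simp
      rw [this]; exact h₂ x
    have h0 := h₀ x
    set a := f x / p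
    set b := g x / q
    set J := p * q * I x
    by_cases hab : a + b ≤ 1
    · linarith
    · push Not at hab
      -- otherwise `(a + b) (3 - (a + b)) ≥ 2 ≥ (a + b) J`
      have : (a + b) * J ≤ (a + b) * (3 - (a + b)) := by
        nlinarith [mul_nonneg (sub_nonneg.2 hab.le) (by linarith : 0 ≤ 2 - (a + b))]
      exact le_of_mul_le_mul_left this (by linarith)
  have hint : ∫ x, p * q * I x ∂P ≤ ∫ x, (3 - (f x / p + g x / q)) ∂P :=
    integral_mono_ae (hI.const_mul _)
      ((integrable_const _).sub ((hf.div_const p).add (hg.div_const q))) key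
  have hfg : Integrable (fun x => f x / p + g x / q) P := (hf.div_const p).add (hg.div_const q)
  rw [integral_const_mul, integral_sub (integrable_const _) hfg,
    integral_add (hf.div_const p) (hg.div_const q),
    integral_div, integral_div] at hint
  simp only [integral_const, probReal_univ, smul_eq_mul, one_mul] at hint
  set F := ∫ x, f x ∂P
  set G := ∫ x, g x ∂P
  set K := ∫ x, I x ∂P
  have ha : F / p ≤ 1 := (div_le_one hp).2 hfi
  have hb : G / q ≤ 1 := (div_le_one hq).2 hgi
  have ha0 : 0 ≤ F / p := div_nonneg hfi0 hp.le
  have hb0 : 0 ≤ G / q := div_nonneg hgi0 hq.le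
  have e : F * G * K = F / p * (G / q) * (p * q * K) := by field_simp
  rw [e]
  calc F / p * (G / q) * (p * q * K)
      ≤ F / p * (G / q) * (3 - (F / p + G / q)) :=
        mul_le_mul_of_nonneg_left hint (mul_nonneg ha0 hb0)
    _ ≤ 1 := by
      set a := F / p
      set b := G / q
      have h3 : 0 ≤ 3 - (a + b) := by linarith
      have : a * b * (3 - (a + b)) ≤ ((a + b) / 2) ^ 2 * (3 - (a + b)) :=
        mul_le_mul_of_nonneg_right (by nlinarith [sq_nonneg (a - b)]) h3
      nlinarith [mul_nonneg (sq_nonneg (1 - (a + b) / 2)) (by linarith : 0 ≤ 1 + (a + b))]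

theorem integrable_of_measurable_of_bounds {Ω : Type*} [MeasurableSpace Ω] {P : Measure Ω}
    [IsFiniteMeasure P] {f : Ω → ℝ} (hf : Measurable f) {C : ℝ} (h0 : ∀ x, 0 ≤ f x)
    (hC : ∀ x, f x ≤ C) : Integrable f P :=
  Integrable.of_bound hf.aestronglyMeasurable C
    (.of_forall fun x => by rw [Real.norm_of_nonneg (h0 x)]; exact hC x)

theorem measureReal_eq_integral_section {Ω Ω' : Type*} [MeasurableSpace Ω] [MeasurableSpace Ω']
    (P : Measure Ω) (P' : Measure Ω') [IsProbabilityMeasure P] [IsProbabilityMeasure P']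
    {A : Set (Ω × Ω')} (hA : MeasurableSet A) :
    (P.prod P').real A = ∫ x, P'.real (Prod.mk x ⁻¹' A) ∂P := by
  rw [measureReal_def, Measure.prod_apply hA, integral_eq_lintegral_of_nonneg_ae]
  · simp [measureReal_def]
  · exact .of_forall fun _ => measureReal_nonneg
  · exact (measurable_measure_prodMk_left hA).ennreal_toReal.aestronglyMeasurable

/-- A set in a product is almost surely covered by its essential projection. Unlike the projection,
the essential projection is measurable. -/
theorem ae_measureReal_section_le_essential_projection {Ω Ω' : Type*} [MeasurableSpace Ω]
    [MeasurableSpace Ω'] (P : Measure Ω) (P' : Measure Ω') [IsProbabilityMeasure P]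
    [IsProbabilityMeasure P'] {A : Set (Ω × Ω')} (hA : MeasurableSet A) :
    ∀ᵐ x ∂P, P'.real (Prod.mk x ⁻¹' A) ≤ P'.real {y | P ((fun x => (x, y)) ⁻¹' A) ≠ 0} := by
  set B : Set Ω' := {y | P ((fun x => (x, y)) ⁻¹' A) ≠ 0} with hB
  have hBm : MeasurableSet B :=
    (measurable_measure_prodMk_right hA) (measurableSet_singleton 0).compl
  set N : Set (Ω × Ω') := A ∩ Prod.snd ⁻¹' Bᶜ with hN
  have hNm : MeasurableSet N := hA.inter (measurable_snd hBm.compl)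
  have hN0 : (P.prod P') N = 0 := by
    rw [Measure.prod_apply_symm hNm, lintegral_eq_zero_iff (measurable_measure_prodMk_right hNm)]
    refine .of_forall fun y => ?_
    by_cases hy : y ∈ B
    · have : (fun x => (x, y)) ⁻¹' N = ∅ := by
        ext x; simp [hN, hy]
      simp [this]
    · have h0 : P ((fun x => (x, y)) ⁻¹' A) = 0 := by simpa [hB] using hy
      exact measure_mono_null (fun x hx => hx.1) h0
  filter_upwards [(Measure.measure_prod_null hNm).1 hN0] with x hx
  have hx' : P' (Prod.mk x ⁻¹' N) = 0 := hx
  have hsub : Prod.mk x ⁻¹' A ⊆ B ∪ Prod.mk x ⁻¹' N := by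
    intro y hy
    by_cases hyB : y ∈ B
    · exact Or.inl hyB
    · exact Or.inr ⟨hy, hyB⟩
  calc P'.real (Prod.mk x ⁻¹' A) ≤ P'.real (B ∪ Prod.mk x ⁻¹' N) := measureReal_mono hsub
    _ ≤ P'.real B + P'.real (Prod.mk x ⁻¹' N) := measureReal_union_le _ _
    _ = P'.real B := by simp [measureReal_def, hx']

open scoped Classical in
/-- The number of coordinates of `x` that are found neither in `y` nor in `z`. -/
noncomputable def uncovered {ι : Type*} [Fintype ι] {Ω : ι → Type*} (x y z : ∀ j, Ω j) : ℕ :=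
  (Finset.univ.filter fun j => x j ≠ y j ∧ x j ≠ z j).card

theorem uncovered_cons {m : ℕ} {Ω : Fin (m + 1) → Type*} (w w₁ w₂ : Ω 0)
    (x y z : ∀ j : Fin m, Ω j.succ) :
    uncovered (Fin.cons w x : ∀ j, Ω j) (Fin.cons w₁ y) (Fin.cons w₂ z) =
      (open scoped Classical in if w ≠ w₁ ∧ w ≠ w₂ then 1 else 0) + uncovered x y z := by
  classical
  unfold uncovered
  rw [Fin.univ_succ, Finset.filter_cons]
  split_ifs with h1 h2 h2
  · rw [Finset.card_cons, Finset.filter_map, Finset.card_map, add_comm]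
    congr
  · exact absurd h1 (by simpa using h2)
  · exact absurd h2 (by simpa using h1)
  · rw [Finset.filter_map, Finset.card_map, zero_add]
    congr

theorem uncovered_le {m : ℕ} {Ω : Fin m → Type*} (x y z : ∀ j, Ω j) : uncovered x y z ≤ m := by
  classical
  exact (Finset.card_le_univ _).trans (by simp)

theorem exists_measurableEquiv_cons {m : ℕ} {Ω : Fin (m + 1) → Type*} [∀ j, MeasurableSpace (Ω j)]
    (P : ∀ j, Measure (Ω j)) [∀ j, IsProbabilityMeasure (P j)] :
    ∃ e : (Ω 0 × ∀ j : Fin m, Ω j.succ) ≃ᵐ (∀ j, Ω j),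
      (∀ w x, e (w, x) = (Fin.cons w x : ∀ j, Ω j)) ∧
      MeasurePreserving e ((P 0).prod (Measure.pi fun j : Fin m => P j.succ)) (Measure.pi P) :=
  ⟨(MeasurableEquiv.piFinSuccAbove Ω 0).symm,
    fun w x => funext fun j => by refine Fin.cases ?_ (fun _ => ?_) j <;> rfl,
    (measurePreserving_piFinSuccAbove P 0).symm⟩

/-- Talagrand's inequality for control by two points: for independent coordinates,
`E [2 ^ f] ≤ 1 / (Pr[A] Pr[B])`, where `f x` is the least number of coordinates of `x` that are
found neither in `y` nor in `z`, over `y ∈ A` and `z ∈ B`. Since `f` need not be measurable, the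
inequality is stated for measurable minorants `G` of `2 ^ f`. The induction on the number of
coordinates compares the sections of `A` and `B` with their essential projections. -/
theorem two_point_concentration (m : ℕ) : ∀ (Ω : Fin m → Type*) [∀ j, MeasurableSpace (Ω j)]
    (P : ∀ j, Measure (Ω j)) [∀ j, IsProbabilityMeasure (P j)] (A B : Set (∀ j, Ω j))
    (_ : MeasurableSet A) (_ : MeasurableSet B) (G : (∀ j, Ω j) → ℝ) (_ : Measurable G)
    (_ : ∀ x, 0 ≤ G x) (_ : ∀ x, ∀ y ∈ A, ∀ z ∈ B, G x ≤ 2 ^ uncovered x y z),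
    (Measure.pi P).real A * (Measure.pi P).real B * ∫ x, G x ∂(Measure.pi P) ≤ 1 := by
  induction m with
  | zero =>
    intro Ω _ P _ A B hA hB G hG hG0 h
    rcases A.eq_empty_or_nonempty with rfl | ⟨y, hy⟩
    · simp
    rcases B.eq_empty_or_nonempty with rfl | ⟨z, hz⟩
    · simp
    have hG1 : ∀ x, G x ≤ 1 := fun x => by
      simpa [uncovered] using h x y hy z hz
    have hI : ∫ x, G x ∂(Measure.pi P) ≤ 1 := by
      simpa using integral_mono (integrable_of_measurable_of_bounds (P := Measure.pi P) hG hG0 hG1)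
        (integrable_const 1) hG1
    exact mul_le_one₀ (mul_le_one₀ measureReal_le_one measureReal_nonneg measureReal_le_one)
      (integral_nonneg hG0) hI
  | succ m ih =>
    intro Ω _ P _ A B hA hB G hG hG0 h
    rcases A.eq_empty_or_nonempty with rfl | ⟨y, hy⟩
    · simp
    rcases B.eq_empty_or_nonempty with rfl | ⟨z, hz⟩
    · simp
    have hG1 : ∀ x, G x ≤ 2 ^ (m + 1) := fun x =>
      (h x y hy z hz).trans (pow_le_pow_right₀ (by norm_num) (uncovered_le x y z))
    clear hy hz y z
    set P' : ∀ j : Fin m, Measure (Ω j.succ) := fun j => P j.succ with hP'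
    obtain ⟨e, hcons, hmp⟩ := exists_measurableEquiv_cons P
    set A' : Set (Ω 0 × ∀ j : Fin m, Ω j.succ) := e ⁻¹' A with hA'
    set B' : Set (Ω 0 × ∀ j : Fin m, Ω j.succ) := e ⁻¹' B with hB'
    have hA'm : MeasurableSet A' := e.measurable hA
    have hB'm : MeasurableSet B' := e.measurable hB
    have hGe : Measurable fun x => G (e x) := hG.comp e.measurable
    set EA : Set (∀ j : Fin m, Ω j.succ) := {y | P 0 ((fun x => (x, y)) ⁻¹' A') ≠ 0} with hEA
    set EB : Set (∀ j : Fin m, Ω j.succ) := {y | P 0 ((fun x => (x, y)) ⁻¹' B') ≠ 0} with hEB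
    have hEAm : MeasurableSet EA :=
      (measurable_measure_prodMk_right hA'm) (measurableSet_singleton 0).compl
    have hEBm : MeasurableSet EB :=
      (measurable_measure_prodMk_right hB'm) (measurableSet_singleton 0).compl
    have hEA_mem : ∀ y ∈ EA, ∃ w, (Fin.cons w y : ∀ j, Ω j) ∈ A := by
      intro y hy
      obtain ⟨w, hw⟩ := nonempty_of_measure_ne_zero hy
      exact ⟨w, by rw [← hcons]; exact hw⟩
    have hEB_mem : ∀ y ∈ EB, ∃ w, (Fin.cons w y : ∀ j, Ω j) ∈ B := by
      intro y hy
      obtain ⟨w, hw⟩ := nonempty_of_measure_ne_zero hy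
      exact ⟨w, by rw [← hcons]; exact hw⟩
    have hGint : Integrable (fun x => G (e x)) ((P 0).prod (Measure.pi P')) :=
      integrable_of_measurable_of_bounds hGe (fun _ => hG0 _) (fun _ => hG1 _)
    rw [← hmp.measureReal_preimage hA.nullMeasurableSet,
      ← hmp.measureReal_preimage hB.nullMeasurableSet, ← hmp.integral_comp' G,
      measureReal_eq_integral_section _ _ hA'm, measureReal_eq_integral_section _ _ hB'm,
      integral_prod _ hGint]
    have hsec : ∀ {C : Set (Ω 0 × ∀ j : Fin m, Ω j.succ)}, MeasurableSet C →
        Integrable (fun x => (Measure.pi P').real (Prod.mk x ⁻¹' C)) (P 0) := fun hC =>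
      integrable_of_measurable_of_bounds (measurable_measure_prodMk_left hC).ennreal_toReal
        (fun _ => measureReal_nonneg) (fun _ => measureReal_le_one)
    refine integral_mul_integral_mul_integral_le_one (P 0) (p := (Measure.pi P').real EA)
      (q := (Measure.pi P').real EB) (hsec hA'm) (hsec hB'm) hGint.integral_prod_left
      measureReal_nonneg measureReal_nonneg (fun _ => measureReal_nonneg)
      (fun _ => measureReal_nonneg)
      (ae_measureReal_section_le_essential_projection _ _ hA'm)
      (ae_measureReal_section_le_essential_projection _ _ hB'm) ?_ ?_ ?_
    · intro w
      have := ih (fun j => Ω j.succ) P' EA EB hEAm hEBm (fun x => G (e (w, x)) / 2)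
        ((hGe.comp measurable_prodMk_left).div_const 2) (fun x => div_nonneg (hG0 _) zero_le_two)
        (by
          intro x y hy z hz
          obtain ⟨w₁, h₁⟩ := hEA_mem y hy
          obtain ⟨w₂, h₂⟩ := hEB_mem z hz
          have := h (e (w, x)) _ h₁ _ h₂
          rw [hcons, uncovered_cons, pow_add] at this
          rw [div_le_iff₀ two_pos, hcons, mul_comm]
          refine this.trans (mul_le_mul_of_nonneg_right ?_ (by positivity))
          split_ifs <;> norm_num)
      rw [integral_div] at this
      linarith
    · intro w
      refine ih (fun j => Ω j.succ) P' (Prod.mk w ⁻¹' A') EB (measurable_prodMk_left hA'm) hEBm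
        (fun x => G (e (w, x))) (hGe.comp measurable_prodMk_left) (fun x => hG0 _) ?_
      intro x y hy z hz
      obtain ⟨w₂, h₂⟩ := hEB_mem z hz
      have h₁ : (Fin.cons w y : ∀ j, Ω j) ∈ A := by rw [← hcons]; exact hy
      have := h (e (w, x)) _ h₁ _ h₂
      simp only [hcons] at this ⊢
      simpa [uncovered_cons] using this
    · intro w
      refine ih (fun j => Ω j.succ) P' EA (Prod.mk w ⁻¹' B') hEAm (measurable_prodMk_left hB'm)
        (fun x => G (e (w, x))) (hGe.comp measurable_prodMk_left) (fun x => hG0 _) ?_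
      intro x y hy z hz
      obtain ⟨w₁, h₁⟩ := hEA_mem y hy
      have h₂ : (Fin.cons w z : ∀ j, Ω j) ∈ B := by rw [← hcons]; exact hz
      have := h (e (w, x)) _ h₁ _ h₂
      simp only [hcons] at this ⊢
      simpa [uncovered_cons] using this

/-- The mean is at most twice the median plus twice the Lipschitz constant. If `y` and `z` both have
value at most `a`, then the value of `x` is at most `2 a` plus `L` for every coordinate of `x` that
is found neither in `y` nor in `z`. Hence `G = 2 ^ ((h - 2 a)⁺ / L)` satisfies the assumption of
`two_point_concentration` and `E G ≤ 4`; by convexity `E (h - 2 a)⁺ ≤ 2 L`. -/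
theorem integral_le_two_mul_median_add_of_pos {m : ℕ} {Ω : Fin m → Type*}
    [∀ j, MeasurableSpace (Ω j)]
    (P : ∀ j, Measure (Ω j)) [∀ j, IsProbabilityMeasure (P j)]
    {h : (∀ j, Ω j) → Finset (Fin m) → ℝ} {S : Finset (Fin m)} {a L : ℝ}
    (hmeas : Measurable fun x => h x S) (hempty : ∀ x, h x ∅ = 0)
    (hmono : ∀ x U W, U ⊆ W → h x U ≤ h x W) (hsub : ∀ x U W, h x (U ∪ W) ≤ h x U + h x W)
    (hloc : ∀ x y U, (∀ j ∈ U, x j = y j) → h x U = h y U)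
    (hL : 0 < L) (hLip : ∀ x j, h x {j} ≤ L)
    (ha : 1 / 2 ≤ (Measure.pi P).real {x | h x S ≤ a}) :
    ∫ x, h x S ∂(Measure.pi P) ≤ 2 * a + 2 * L := by
  classical
  have hcard : ∀ x (U : Finset (Fin m)), h x U ≤ U.card * L := by
    intro x U
    induction U using Finset.induction_on with
    | empty => simp [hempty]
    | insert j U hj ih =>
      rw [Finset.card_insert_of_notMem hj, Finset.insert_eq]
      push_cast
      linarith [hsub x {j} U, hLip x j]
  have hnonneg : ∀ x U, 0 ≤ h x U := fun x U => by
    rw [← hempty x]; exact hmono x _ _ (Finset.empty_subset U)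
  set N : (∀ j, Ω j) → ℝ := fun x => max (h x S - 2 * a) 0 / L with hN
  have hNm : Measurable N := ((hmeas.sub_const _).max measurable_const).div_const L
  have hN0 : ∀ x, 0 ≤ N x := fun x => div_nonneg (le_max_right _ _) hL.le
  have hNcov : ∀ x, ∀ y ∈ {x | h x S ≤ a}, ∀ z ∈ {x | h x S ≤ a}, N x ≤ uncovered x y z := by
    intro x y hy z hz
    rw [hN, div_le_iff₀ hL]
    refine max_le ?_ (by positivity)
    set R := S.filter fun j => x j ≠ y j ∧ x j ≠ z j with hR
    set U := S.filter fun j => x j = y j with hU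
    set W := S.filter fun j => x j = z j with hW
    have hcover : S ⊆ U ∪ W ∪ R := by
      intro j hj
      by_cases h1 : x j = y j
      · simp [hU, hj, h1]
      by_cases h2 : x j = z j
      · simp [hW, hj, h2]
      · simp [hR, hj, h1, h2]
    have hUa : h x U ≤ a := by
      rw [hloc x y U fun j hj => (Finset.mem_filter.1 hj).2]
      exact (hmono y _ _ (Finset.filter_subset _ _)).trans hy
    have hWa : h x W ≤ a := by
      rw [hloc x z W fun j hj => (Finset.mem_filter.1 hj).2]
      exact (hmono z _ _ (Finset.filter_subset _ _)).trans hz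
    have hRc : (R.card : ℝ) ≤ uncovered x y z := by
      refine Nat.cast_le.2 (Finset.card_le_card ?_)
      intro j hj
      have := (Finset.mem_filter.1 hj).2
      simp [this]
    have h1 := hmono x _ _ hcover
    have h2 := hsub x (U ∪ W) R
    have h3 := hsub x U W
    have h4 := hcard x R
    have h5 := mul_le_mul_of_nonneg_right hRc hL.le
    linarith
  have hAm : MeasurableSet {x | h x S ≤ a} := hmeas measurableSet_Iic
  have htal := two_point_concentration m Ω P _ _ hAm hAm (fun x => (2 : ℝ) ^ N x)
    (measurable_const.pow hNm) (fun x => by positivity) (fun x y hy z hz => by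
      rw [← Real.rpow_natCast]
      exact Real.rpow_le_rpow_of_exponent_le one_le_two (hNcov x y hy z hz))
  obtain ⟨y, hy⟩ : {x | h x S ≤ a}.Nonempty := by
    rw [Set.nonempty_iff_ne_empty]
    intro he
    rw [he] at ha
    norm_num at ha
  have hNm_le : ∀ x, N x ≤ m := fun x =>
    (hNcov x y hy y hy).trans (Nat.cast_le.2 (uncovered_le x y y))
  have hNint : Integrable N (Measure.pi P) := integrable_of_measurable_of_bounds hNm hN0 hNm_le
  have hGint : Integrable (fun x => (2 : ℝ) ^ N x) (Measure.pi P) :=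
    integrable_of_measurable_of_bounds (measurable_const.pow hNm) (fun x => by positivity)
      (C := (2 : ℝ) ^ (m : ℝ)) fun x => Real.rpow_le_rpow_of_exponent_le one_le_two (hNm_le x)
  have hG4 : ∫ x, (2 : ℝ) ^ N x ∂(Measure.pi P) ≤ 4 := by
    have hI0 : 0 ≤ ∫ x, (2 : ℝ) ^ N x ∂(Measure.pi P) := integral_nonneg fun x => by positivity
    nlinarith [mul_le_mul_of_nonneg_right (mul_le_mul ha ha (by norm_num) (by linarith)) hI0]
  -- the tangent of `2 ^ s` at `s = 2`
  have htan : ∀ x, 4 * (1 + (N x - 2) * Real.log 2) ≤ (2 : ℝ) ^ N x := by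
    intro x
    have e : (2 : ℝ) ^ N x = 4 * Real.exp ((N x - 2) * Real.log 2) := by
      have h2 : (2 : ℝ) ^ N x = (2 : ℝ) ^ (N x - 2) * (2 : ℝ) ^ (2 : ℝ) := by
        rw [← Real.rpow_add two_pos]; ring_nf
      rw [h2, Real.rpow_def_of_pos two_pos (N x - 2)]
      norm_num
      ring_nf
    rw [e]
    linarith [Real.add_one_le_exp ((N x - 2) * Real.log 2)]
  have hlog : 0 < Real.log 2 := Real.log_pos one_lt_two
  have hN2 : ∫ x, N x ∂(Measure.pi P) ≤ 2 := by
    have hlin : Integrable (fun x => (N x - 2) * Real.log 2) (Measure.pi P) :=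
      (hNint.sub (integrable_const 2)).mul_const _
    have := integral_mono (((integrable_const 1).add hlin).const_mul 4) hGint htan
    have e : ∫ x, 4 * (1 + (N x - 2) * Real.log 2) ∂(Measure.pi P) =
        4 * (1 + (∫ x, N x ∂(Measure.pi P) - 2) * Real.log 2) := by
      rw [integral_const_mul, integral_add (integrable_const 1) hlin, integral_mul_const,
        integral_sub hNint (integrable_const 2)]
      simp
    have h4 := (e.symm.le.trans this).trans hG4
    by_contra! hlt
    nlinarith [mul_pos (sub_pos.2 hlt) hlog]
  have hle : ∀ x, h x S ≤ 2 * a + L * N x := by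
    intro x
    rw [hN, mul_div_cancel₀ _ hL.ne']
    linarith [le_max_left (h x S - 2 * a) 0]
  calc ∫ x, h x S ∂(Measure.pi P) ≤ ∫ x, (2 * a + L * N x) ∂(Measure.pi P) :=
        integral_mono (integrable_of_measurable_of_bounds hmeas (fun x => hnonneg x S)
          fun x => hcard x S) ((integrable_const _).add (hNint.const_mul L)) hle
    _ = 2 * a + L * ∫ x, N x ∂(Measure.pi P) := by
        rw [integral_add (integrable_const _) (hNint.const_mul L)]
        simp [integral_const_mul]
    _ ≤ 2 * a + 2 * L := by nlinarith

theorem integral_le_two_mul_median_add {m : ℕ} {Ω : Fin m → Type*} [∀ j, MeasurableSpace (Ω j)]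
    (P : ∀ j, Measure (Ω j)) [∀ j, IsProbabilityMeasure (P j)]
    {h : (∀ j, Ω j) → Finset (Fin m) → ℝ} {S : Finset (Fin m)} {a L : ℝ}
    (hmeas : Measurable fun x => h x S) (hempty : ∀ x, h x ∅ = 0)
    (hmono : ∀ x U W, U ⊆ W → h x U ≤ h x W) (hsub : ∀ x U W, h x (U ∪ W) ≤ h x U + h x W)
    (hloc : ∀ x y U, (∀ j ∈ U, x j = y j) → h x U = h y U)
    (hL : 0 ≤ L) (hLip : ∀ x j, h x {j} ≤ L)
    (ha : 1 / 2 ≤ (Measure.pi P).real {x | h x S ≤ a}) :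
    ∫ x, h x S ∂(Measure.pi P) ≤ 2 * a + 2 * L := by
  refine le_of_forall_pos_le_add fun ε hε => ?_
  have := integral_le_two_mul_median_add_of_pos P hmeas hempty hmono hsub hloc
    (L := L + ε / 2) (by linarith) (fun x j => (hLip x j).trans (by linarith)) ha
  linarith

/-! ### Resampling one coordinate of a product measure -/

section Resampling

variable {n : ℕ} {Ω : Fin n → Type*} [∀ i, MeasurableSpace (Ω i)] (μ : ∀ i, Measure (Ω i))
  [∀ i, IsProbabilityMeasure (μ i)]

theorem measurePreserving_update (i : Fin n) :
    MeasurePreserving (fun z : (∀ k, Ω k) × Ω i => Function.update z.1 i z.2)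
      ((Measure.pi μ).prod (μ i)) (Measure.pi μ) := by
  have hm : Measurable fun z : (∀ k, Ω k) × Ω i => Function.update z.1 i z.2 :=
    measurable_update'
  refine ⟨hm, (Measure.pi_eq fun s hs => ?_).symm⟩
  rw [Measure.map_apply hm (MeasurableSet.univ_pi hs)]
  have e : (fun z : (∀ k, Ω k) × Ω i => Function.update z.1 i z.2) ⁻¹' Set.univ.pi s =
      Set.univ.pi (Function.update s i Set.univ) ×ˢ s i := by
    ext ⟨t, x⟩
    simp only [Set.mem_preimage, Set.mem_pi, Set.mem_univ, true_imp_iff, Set.mem_prod]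
    constructor
    · intro h
      refine ⟨fun k => ?_, by simpa using h i⟩
      by_cases hk : k = i
      · subst hk; simp
      · simpa [hk] using h k
    · rintro ⟨h, hx⟩ k
      by_cases hk : k = i
      · subst hk; simpa using hx
      · simpa [hk] using h k
  rw [e, Measure.prod_prod, Measure.pi_pi, ← Finset.mul_prod_erase _ _ (Finset.mem_univ i),
    ← Finset.mul_prod_erase _ (fun k => μ k (s k)) (Finset.mem_univ i)]
  simp only [Function.update_self, measure_univ, one_mul]
  rw [mul_comm]
  congr 1
  exact Finset.prod_congr rfl fun k hk => by rw [Function.update_of_ne (Finset.ne_of_mem_erase hk)]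

theorem integral_integral_update (i : Fin n) {f : (∀ k, Ω k) → ℝ} (hf : Measurable f) {C : ℝ}
    (h0 : ∀ t, 0 ≤ f t) (hC : ∀ t, f t ≤ C) :
    ∫ x, ∫ t, f (Function.update t i x) ∂(Measure.pi μ) ∂(μ i) = ∫ t, f t ∂(Measure.pi μ) := by
  have hmp := measurePreserving_update μ i
  have hint : Integrable (fun z : (∀ k, Ω k) × Ω i => f (Function.update z.1 i z.2))
      ((Measure.pi μ).prod (μ i)) :=
    integrable_of_measurable_of_bounds (hf.comp hmp.measurable) (fun _ => h0 _) (fun _ => hC _)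
  rw [← integral_prod_symm _ hint]
  conv_rhs => rw [← hmp.map_eq]
  rw [integral_map hmp.measurable.aemeasurable hf.aestronglyMeasurable]

/-- A function of coordinate `i` is independent of a function that ignores coordinate `i`. -/
theorem integral_mul_of_update_invariant (i : Fin n) {f : Ω i → ℝ} {g : (∀ k, Ω k) → ℝ}
    (hf : Measurable f) (hg : Measurable g) (hgi : ∀ t x, g (Function.update t i x) = g t) :
    ∫ t, g t * f (t i) ∂(Measure.pi μ) = (∫ t, g t ∂(Measure.pi μ)) * ∫ x, f x ∂(μ i) := by
  have hmp := measurePreserving_update μ i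
  have hm : Measurable fun t : ∀ k, Ω k => g t * f (t i) :=
    hg.mul (hf.comp (measurable_pi_apply i))
  rw [← integral_prod_mul g f]
  conv_lhs => rw [← hmp.map_eq]
  rw [integral_map hmp.measurable.aemeasurable hm.aestronglyMeasurable]
  simp [hgi]

theorem measureReal_inter_of_update_invariant (i : Fin n) {E : Set (Ω i)} {F : Set (∀ k, Ω k)}
    (hE : MeasurableSet E) (hF : MeasurableSet F)
    (hFi : ∀ t x, Function.update t i x ∈ F ↔ t ∈ F) :
    (Measure.pi μ).real {t | t ∈ F ∧ t i ∈ E} = (Measure.pi μ).real F * (μ i).real E := by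
  have hm : MeasurableSet {t : ∀ k, Ω k | t ∈ F ∧ t i ∈ E} :=
    hF.inter (measurable_pi_apply i hE)
  rw [← integral_indicator_one hF, ← integral_indicator_one hE,
    ← integral_mul_of_update_invariant μ i (measurable_one.indicator hE)
      (measurable_one.indicator hF)
      (fun t x => by by_cases h : t ∈ F <;> simp [Set.indicator, (hFi t x), h]),
    ← integral_indicator_one hm]
  refine integral_congr_ae (.of_forall fun t => ?_)
  by_cases h1 : t ∈ F <;> by_cases h2 : t i ∈ E <;> simp [Set.indicator, h1, h2]

theorem measureReal_eval_preimage (i : Fin n) {E : Set (Ω i)} (hE : MeasurableSet E) :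
    (Measure.pi μ).real {t | t i ∈ E} = (μ i).real E := by
  simpa using measureReal_inter_of_update_invariant μ i hE MeasurableSet.univ (by simp)

end Resampling

/-! ### Tail probabilities, cutoffs and medians -/

section Tails

open Filter Topology

variable {Ω : Type*} [MeasurableSpace Ω] (P : Measure Ω)

theorem tendsto_measureReal_of_eventually_mem_iff [IsFiniteMeasure P] {A : Set Ω}
    {As : ℕ → Set Ω} (hAs : ∀ k, MeasurableSet (As k))
    (h : ∀ ω, ∀ᶠ k in atTop, ω ∈ As k ↔ ω ∈ A) :
    Tendsto (fun k => P.real (As k)) atTop (𝓝 (P.real A)) :=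
  (ENNReal.tendsto_toReal (measure_ne_top P A)).comp
    (tendsto_measure_of_tendsto_indicator_of_isFiniteMeasure atTop P hAs h)

/-- Tail probabilities are left continuous. -/
theorem tendsto_measureReal_le [IsFiniteMeasure P] {h : Ω → ℝ} (hh : Measurable h) {u : ℕ → ℝ}
    {x : ℝ} (hu : ∀ k, u k ≤ x) (hux : Tendsto u atTop (𝓝 x)) :
    Tendsto (fun k => P.real {ω | u k ≤ h ω}) atTop (𝓝 (P.real {ω | x ≤ h ω})) := by
  refine tendsto_measureReal_of_eventually_mem_iff P (fun k => hh measurableSet_Ici) fun ω => ?_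
  rcases le_or_gt x (h ω) with hx | hx
  · exact .of_forall fun k => by simp [hx, (hu k).trans hx]
  · filter_upwards [hux.eventually_const_lt hx] with k hk
    simp [hx.not_ge, hk.not_ge]

theorem tendsto_sub_const_div (x c : ℝ) :
    Tendsto (fun k : ℕ => x - c * (1 / ((k : ℝ) + 1))) atTop (𝓝 x) := by
  simpa using (tendsto_one_div_add_atTop_nhds_zero_nat (𝕜 := ℝ)).const_mul c |>.const_sub x

/-- A left continuous function is still at least `1 / 2` at a positive cutoff
`inf {x ≥ 0 | F x ≤ 1 / 2}`. -/
theorem half_le_of_sInf_pos {F : ℝ → ℝ} {c : ℝ} (hc : c = sInf {x | 0 ≤ x ∧ F x ≤ 1 / 2})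
    (hpos : 0 < c) (hF : ∀ u : ℕ → ℝ, (∀ k, u k ≤ c) → Tendsto u atTop (𝓝 c) →
      Tendsto (fun k => F (u k)) atTop (𝓝 (F c))) : 1 / 2 ≤ F c := by
  have hk : ∀ k : ℕ, 0 < 1 / ((k : ℝ) + 1) ∧ 1 / ((k : ℝ) + 1) ≤ 1 := fun k =>
    ⟨by positivity, by rw [div_le_one (by positivity)]; linarith [k.cast_nonneg (α := ℝ)]⟩
  refine ge_of_tendsto (hF _ (fun k => ?_) (tendsto_sub_const_div c c)) (.of_forall fun k => ?_)
  · nlinarith [hk k]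
  · by_contra! hlt
    have hmem : c - c * (1 / ((k : ℝ) + 1)) ∈ {x | 0 ≤ x ∧ F x ≤ 1 / 2} :=
      ⟨by nlinarith [hk k], hlt.le⟩
    have : c ≤ c - c * (1 / ((k : ℝ) + 1)) := by
      conv_lhs => rw [hc]
      exact csInf_le ⟨0, fun x hx => hx.1⟩ hmem
    nlinarith [hk k]

theorem tendsto_measureReal_le_natCast_atTop [IsProbabilityMeasure P] {h : Ω → ℝ}
    (hh : Measurable h) : Tendsto (fun k : ℕ => P.real {ω | h ω ≤ k}) atTop (𝓝 1) := by
  rw [← probReal_univ (μ := P)]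
  refine tendsto_measureReal_of_eventually_mem_iff P (fun k => hh measurableSet_Iic) fun ω => ?_
  filter_upwards [eventually_ge_atTop ⌈h ω⌉₊] with k hk
  simpa using (Nat.le_ceil _).trans (Nat.cast_le.2 hk)

theorem median_set_nonempty [IsProbabilityMeasure P] {h : Ω → ℝ} (hh : Measurable h) :
    {a | 0 ≤ a ∧ 1 / 2 ≤ P.real {x | h x ≤ a}}.Nonempty := by
  obtain ⟨k, hk⟩ := ((tendsto_measureReal_le_natCast_atTop P hh).eventually_const_lt
    (by norm_num : (1 / 2 : ℝ) < 1)).exists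
  exact ⟨k, k.cast_nonneg, hk.le⟩

theorem median_nonneg (h : Ω → ℝ) : 0 ≤ median P h := Real.sInf_nonneg fun _ hx => hx.1

theorem half_le_measureReal_le_median [IsProbabilityMeasure P] {h : Ω → ℝ} (hh : Measurable h) :
    1 / 2 ≤ P.real {ω | h ω ≤ median P h} := by
  have hpos : ∀ k : ℕ, 0 < 1 / ((k : ℝ) + 1) := fun k => by positivity
  have hlim : Tendsto (fun k : ℕ => median P h + 1 / ((k : ℝ) + 1)) atTop (𝓝 (median P h)) := by
    simpa using (tendsto_one_div_add_atTop_nhds_zero_nat (𝕜 := ℝ)).const_add (median P h)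
  refine ge_of_tendsto (tendsto_measureReal_of_eventually_mem_iff P
    (As := fun k : ℕ => {ω | h ω ≤ median P h + 1 / ((k : ℝ) + 1)})
    (fun k => hh measurableSet_Iic) fun ω => ?_) (.of_forall fun k => ?_)
  · rcases le_or_gt (h ω) (median P h) with hx | hx
    · exact .of_forall fun k => by
        simp only [Set.mem_ofPred_eq, hx, iff_true]; linarith [hpos k]
    · filter_upwards [hlim.eventually_lt_const hx] with k hk
      simp only [hx.not_ge, hk.not_ge]
  · obtain ⟨a, ha, hlt⟩ := exists_lt_of_csInf_lt (median_set_nonempty P hh)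
      (lt_add_of_pos_right (median P h) (hpos k))
    exact ha.2.trans (measureReal_mono fun ω hω => le_trans hω hlt.le)

theorem half_le_measureReal_median_le [IsProbabilityMeasure P] {h : Ω → ℝ} (hh : Measurable h)
    (h0 : ∀ ω, 0 ≤ h ω) : 1 / 2 ≤ P.real {ω | median P h ≤ h ω} := by
  rcases (median_nonneg P h).eq_or_lt with he | hpos
  · rw [← he]
    simp only [h0, Set.ofPred_true, probReal_univ]
    norm_num
  have hk : ∀ k : ℕ, 0 < 1 / ((k : ℝ) + 1) ∧ 1 / ((k : ℝ) + 1) ≤ 1 := fun k =>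
    ⟨by positivity, by rw [div_le_one (by positivity)]; linarith [k.cast_nonneg (α := ℝ)]⟩
  refine ge_of_tendsto (tendsto_measureReal_le P hh (fun k => ?_)
    (tendsto_sub_const_div (median P h) (median P h))) (.of_forall fun k => ?_)
  · nlinarith [hk k]
  · set u := median P h - median P h * (1 / ((k : ℝ) + 1)) with hu
    have hu0 : 0 ≤ u := by nlinarith [hk k]
    have hlt : P.real {ω | h ω ≤ u} < 1 / 2 := by
      by_contra! hge
      have : median P h ≤ u := csInf_le ⟨0, fun x hx => hx.1⟩ ⟨hu0, hge⟩
      nlinarith [hk k]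
    have hc : P.real {ω | h ω ≤ u}ᶜ = 1 - P.real {ω | h ω ≤ u} :=
      probReal_compl_eq_one_sub (hh measurableSet_Iic)
    have hsub : P.real {ω | h ω ≤ u}ᶜ ≤ P.real {ω | u ≤ h ω} :=
      measureReal_mono fun ω (hω : ¬ h ω ≤ u) => (not_le.1 hω).le
    linarith

end Tails

section TailProb

open Filter Topology

variable {n m : ℕ} {T : Fin n → Fin m → Type*} [∀ i j, MeasurableSpace (T i j)]

instance (D : ∀ i j, Measure (T i j)) [∀ i j, IsProbabilityMeasure (D i j)] (i : Fin n) :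
    IsProbabilityMeasure (bidderDist D i) := by
  unfold bidderDist; infer_instance

instance (D : ∀ i j, Measure (T i j)) [∀ i j, IsProbabilityMeasure (D i j)] :
    IsProbabilityMeasure (profileDist D) := by
  unfold profileDist; infer_instance

variable (D : ∀ i j, Measure (T i j)) {v : Valuation T}

theorem tailProb_nonneg (v : Valuation T) (i : Fin n) (j : Fin m) (x : ℝ) :
    0 ≤ tailProb D v i j x := measureReal_nonneg

theorem coreCutoff_nonneg (v : Valuation T) (β : Fin n → Fin m → ℝ) (i : Fin n) :
    0 ≤ coreCutoff D v β i := Real.sInf_nonneg fun _ hx => hx.1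

theorem feeCutoff_nonneg (v : Valuation T) (β : Fin n → Fin m → ℝ) (Q : Fin m → ℝ) (i : Fin n) :
    0 ≤ feeCutoff D v β Q i := Real.sInf_nonneg fun _ hx => hx.1

variable [∀ i j, IsProbabilityMeasure (D i j)]

theorem SubadditiveOverItems.nonneg (hv : SubadditiveOverItems v) (i : Fin n)
    (t : BidderType T i) (S : Finset (Fin m)) : 0 ≤ v i t S := by
  rw [← hv.empty i t]; exact hv.mono i t _ _ (Finset.empty_subset S)

theorem tailProb_antitone (v : Valuation T) (i : Fin n) (j : Fin m) :
    Antitone (tailProb D v i j) := fun _ _ hxy => measureReal_mono fun _ ht => le_trans hxy ht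

theorem tendsto_tailProb (hv : SubadditiveOverItems v) (i : Fin n) (j : Fin m) {u : ℕ → ℝ} {x : ℝ}
    (hu : ∀ k, u k ≤ x) (hux : Tendsto u atTop (𝓝 x)) :
    Tendsto (fun k => tailProb D v i j (u k)) atTop (𝓝 (tailProb D v i j x)) :=
  tendsto_measureReal_le _ (hv.measurable i {j}) hu hux

theorem tendsto_tailProb_atTop (hv : SubadditiveOverItems v) (i : Fin n) (j : Fin m) :
    Tendsto (fun k : ℕ => tailProb D v i j k) atTop (𝓝 0) := by
  have h := tendsto_measureReal_of_eventually_mem_iff (bidderDist D i) (A := ∅)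
    (As := fun k : ℕ => {t | (k : ℝ) ≤ v i t {j}})
    (fun k => hv.measurable i {j} measurableSet_Ici) (fun t => by
      filter_upwards [eventually_gt_atTop ⌈v i t {j}⌉₊] with k hk
      simpa using (Nat.le_ceil _).trans_lt (Nat.cast_lt.2 hk))
  rw [measureReal_empty] at h
  exact h

theorem half_le_sum_tailProb_coreCutoff (hv : SubadditiveOverItems v) (β : Fin n → Fin m → ℝ)
    (i : Fin n) (h : 0 < coreCutoff D v β i) :
    1 / 2 ≤ ∑ j, tailProb D v i j (β i j + coreCutoff D v β i) :=
  half_le_of_sInf_pos (F := fun x => ∑ j, tailProb D v i j (β i j + x)) rfl h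
    fun _ hu hux => tendsto_finsetSum _ fun j _ => tendsto_tailProb D hv i j
      (fun k => by linarith [hu k]) (hux.const_add _)

theorem half_le_sum_tailProb_feeCutoff (hv : SubadditiveOverItems v) (β : Fin n → Fin m → ℝ)
    (Q : Fin m → ℝ) (i : Fin n) (h : 0 < feeCutoff D v β Q i) :
    1 / 2 ≤ ∑ j, tailProb D v i j (max (β i j) (Q j + feeCutoff D v β Q i)) :=
  half_le_of_sInf_pos (F := fun x => ∑ j, tailProb D v i j (max (β i j) (Q j + x))) rfl h
    fun _ hu hux => tendsto_finsetSum _ fun j _ => tendsto_tailProb D hv i j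
      (fun k => max_le_max_left _ (by linarith [hu k])) (tendsto_const_nhds.max (hux.const_add _))

/-- Above the cutoff the tail probabilities sum up to at most `1 / 2`. At the cutoff itself this
may fail when the distributions have atoms. -/
theorem sum_tailProb_le_half_of_feeCutoff_lt (hv : SubadditiveOverItems v)
    (β : Fin n → Fin m → ℝ) {Q : Fin m → ℝ} (hQ : ∀ j, 0 ≤ Q j) (i : Fin n) {x : ℝ}
    (h : feeCutoff D v β Q i < x) :
    ∑ j, tailProb D v i j (max (β i j) (Q j + x)) ≤ 1 / 2 := by
  have hne : {x | 0 ≤ x ∧ ∑ j, tailProb D v i j (max (β i j) (Q j + x)) ≤ 1 / 2}.Nonempty := by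
    have hlim : Tendsto (fun k : ℕ => ∑ j, tailProb D v i j k) atTop (𝓝 0) := by
      simpa using tendsto_finsetSum Finset.univ fun j _ => tendsto_tailProb_atTop D hv i j
    obtain ⟨k, hk⟩ := (hlim.eventually_lt_const (by norm_num : (0 : ℝ) < 1 / 2)).exists
    refine ⟨k, k.cast_nonneg, (Finset.sum_le_sum fun j _ => ?_).trans hk.le⟩
    exact tailProb_antitone D v i j ((by linarith [hQ j] : (k : ℝ) ≤ Q j + k).trans
      (le_max_right _ _))
  obtain ⟨y, hy, hyx⟩ := exists_lt_of_csInf_lt hne h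
  exact (Finset.sum_le_sum fun j _ => tailProb_antitone D v i j
    (max_le_max_left _ (by linarith))).trans hy.2

end TailProb

/-! ### Truncated valuations, surplus and favourite bundles -/

section Valuations

variable {n m : ℕ} {T : Fin n → Fin m → Type*} {v : Valuation T}

theorem truncate_singleton_of_lt (i : Fin n) {x : Fin m → ℝ} {t : BidderType T i} {j : Fin m}
    (h : v i t {j} < x j) : truncate v i x t {j} = v i t {j} := by
  classical
  rw [truncate, Finset.filter_eq_self.2 (by simpa using h)]

theorem truncate_eq_of_forall_lt (i : Fin n) {x : Fin m → ℝ} {t : BidderType T i}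
    {S : Finset (Fin m)} (h : ∀ j ∈ S, v i t {j} < x j) : truncate v i x t S = v i t S := by
  classical
  rw [truncate, Finset.filter_eq_self.2 h]

variable [∀ i j, MeasurableSpace (T i j)]

theorem truncate_le (hv : SubadditiveOverItems v) (i : Fin n) (x : Fin m → ℝ)
    (t : BidderType T i) (S : Finset (Fin m)) : truncate v i x t S ≤ v i t S :=
  hv.mono i t _ _ (Finset.filter_subset _ _)

theorem truncate_singleton_of_le (hv : SubadditiveOverItems v) (i : Fin n) {x : Fin m → ℝ}
    {t : BidderType T i} {j : Fin m} (h : x j ≤ v i t {j}) : truncate v i x t {j} = 0 := by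
  classical
  rw [truncate, Finset.filter_eq_empty_iff.2 (by simpa using h), hv.empty]

theorem truncate_empty (hv : SubadditiveOverItems v) (i : Fin n) (x : Fin m → ℝ)
    (t : BidderType T i) : truncate v i x t ∅ = 0 := by
  simp [truncate, hv.empty]

theorem truncate_union_le (hv : SubadditiveOverItems v) (i : Fin n) (x : Fin m → ℝ)
    (t : BidderType T i) (U W : Finset (Fin m)) :
    truncate v i x t (U ∪ W) ≤ truncate v i x t U + truncate v i x t W := by
  classical
  unfold truncate
  rw [Finset.filter_union]
  exact hv.subadditive i t _ _

theorem truncate_congr (hv : SubadditiveOverItems v) (i : Fin n) (x : Fin m → ℝ)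
    {t t' : BidderType T i} {S : Finset (Fin m)} (h : ∀ j ∈ S, t j = t' j) :
    truncate v i x t S = truncate v i x t' S := by
  classical
  have e : S.filter (fun j => v i t {j} < x j) = S.filter (fun j => v i t' {j} < x j) :=
    Finset.filter_congr fun j hj => by
      rw [hv.noExternalities i t t' {j} (by simpa using h j hj)]
  unfold truncate
  rw [e]
  exact hv.noExternalities i t t' _ fun j hj => h j (Finset.mem_filter.1 hj).1

theorem measurable_truncate (hv : SubadditiveOverItems v) (i : Fin n) (x : Fin m → ℝ)
    (S : Finset (Fin m)) : Measurable fun t => truncate v i x t S := by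
  classical
  -- the set on which the valuation is evaluated takes finitely many values
  have e : (fun t => truncate v i x t S) = fun t => ∑ U ∈ S.powerset,
      {t | S.filter (fun j => v i t {j} < x j) = U}.indicator (fun t => v i t U) t := by
    funext t
    rw [Finset.sum_eq_single (S.filter fun j => v i t {j} < x j)]
    · simp [truncate, Set.indicator]
    · intro U _ hU
      simp [Set.indicator, hU.symm]
    · intro h
      exact absurd (Finset.mem_powerset.2 (Finset.filter_subset _ _)) h
  rw [e]
  refine Finset.measurable_sum _ fun U _ => (hv.measurable i U).indicator ?_
  have e' : {t | S.filter (fun j => v i t {j} < x j) = U} =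
      ⋂ j, {t | (j ∈ S ∧ v i t {j} < x j) ↔ j ∈ U} := by
    ext t; simp [Finset.ext_iff]
  rw [e']
  refine MeasurableSet.iInter fun j => ?_
  have hm : MeasurableSet {t | j ∈ S ∧ v i t {j} < x j} :=
    (MeasurableSet.const _).inter (hv.measurable i {j} measurableSet_Iio)
  by_cases hj : j ∈ U
  · simpa [hj] using hm
  · simp only [hj, iff_false]
    exact hm.compl

end Valuations

section Surplus

variable {m : ℕ}

theorem surplus_empty {w : Finset (Fin m) → ℝ} (hw : w ∅ = 0) (p : Fin m → ℝ) :
    surplus w p ∅ = 0 := by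
  simp [surplus, hw]

theorem surplus_le_maxSurplus (w : Finset (Fin m) → ℝ) (p : Fin m → ℝ) {S A : Finset (Fin m)}
    (h : S ⊆ A) : surplus w p S ≤ maxSurplus w p A :=
  Finset.le_sup' (surplus w p) (Finset.mem_powerset.2 h)

theorem maxSurplus_le {w : Finset (Fin m) → ℝ} {p : Fin m → ℝ} {A : Finset (Fin m)} {a : ℝ}
    (h : ∀ S ⊆ A, surplus w p S ≤ a) : maxSurplus w p A ≤ a :=
  Finset.sup'_le _ _ fun S hS => h S (Finset.mem_powerset.1 hS)

theorem maxSurplus_nonneg {w : Finset (Fin m) → ℝ} (hw : w ∅ = 0) (p : Fin m → ℝ)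
    (A : Finset (Fin m)) : 0 ≤ maxSurplus w p A := by
  rw [← surplus_empty hw p]
  exact surplus_le_maxSurplus w p (Finset.empty_subset A)

theorem maxSurplus_empty {w : Finset (Fin m) → ℝ} (hw : w ∅ = 0) (p : Fin m → ℝ) :
    maxSurplus w p ∅ = 0 :=
  le_antisymm (maxSurplus_le fun S hS => by rw [Finset.subset_empty.1 hS, surplus_empty hw])
    (maxSurplus_nonneg hw p ∅)

theorem maxSurplus_mono (w : Finset (Fin m) → ℝ) (p : Fin m → ℝ) {A B : Finset (Fin m)}
    (h : A ⊆ B) : maxSurplus w p A ≤ maxSurplus w p B :=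
  maxSurplus_le fun _ hS => surplus_le_maxSurplus w p (hS.trans h)

theorem maxSurplus_mono_left {w w' : Finset (Fin m) → ℝ} (h : ∀ S, w S ≤ w' S) (p : Fin m → ℝ)
    (A : Finset (Fin m)) : maxSurplus w p A ≤ maxSurplus w' p A :=
  maxSurplus_le fun S hS => (sub_le_sub_right (h S) _).trans (surplus_le_maxSurplus w' p hS)

theorem maxSurplus_congr {w w' : Finset (Fin m) → ℝ} (p : Fin m → ℝ) {A : Finset (Fin m)}
    (h : ∀ S ⊆ A, w S = w' S) : maxSurplus w p A = maxSurplus w' p A :=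
  le_antisymm
    (maxSurplus_le fun S hS => by
      rw [surplus, h S hS]; exact surplus_le_maxSurplus w' p hS)
    (maxSurplus_le fun S hS => by
      rw [surplus, ← h S hS]; exact surplus_le_maxSurplus w p hS)

theorem maxSurplus_union_le {w : Finset (Fin m) → ℝ} (hw : ∀ U W, w (U ∪ W) ≤ w U + w W)
    (p : Fin m → ℝ) (A B : Finset (Fin m)) :
    maxSurplus w p (A ∪ B) ≤ maxSurplus w p A + maxSurplus w p B := by
  refine maxSurplus_le fun S hS => ?_
  have h1 := surplus_le_maxSurplus w p (Finset.inter_subset_right : S ∩ A ⊆ A)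
  have h2 := surplus_le_maxSurplus w p (S := S \ A) (A := B) fun j hj => by
    rw [Finset.mem_sdiff] at hj
    exact (Finset.mem_union.1 (hS hj.1)).resolve_left hj.2
  have e : S ∩ A ∪ S \ A = S := by rw [Finset.union_comm, Finset.sdiff_union_inter]
  have h3 := hw (S ∩ A) (S \ A)
  rw [e] at h3
  have h4 := Finset.sum_inter_add_sum_sdiff S A p
  simp only [surplus] at h1 h2 ⊢
  linarith

theorem measurable_maxSurplus {Ω : Type*} [MeasurableSpace Ω] {w : Ω → Finset (Fin m) → ℝ}
    (hw : ∀ S, Measurable fun ω => w ω S) (p : Fin m → ℝ) (A : Finset (Fin m)) :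
    Measurable fun ω => maxSurplus (w ω) p A := by
  have h := Finset.measurable_sup' (Finset.powerset_nonempty A)
    (f := fun S ω => surplus (w ω) p S) fun S _ => (hw S).sub_const _
  convert h using 1
  funext ω
  rw [Finset.sup'_apply]
  rfl

theorem mem_favourites {w : Finset (Fin m) → ℝ} {p : Fin m → ℝ} {F : Finset (Finset (Fin m))}
    {S : Finset (Fin m)} :
    S ∈ favourites w p F ↔ S ∈ F ∧ ∀ S' ∈ F, surplus w p S' ≤ surplus w p S := by
  simp [favourites]

theorem favourites_nonempty (w : Finset (Fin m) → ℝ) (p : Fin m → ℝ)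
    {F : Finset (Finset (Fin m))} (hF : F.Nonempty) : (favourites w p F).Nonempty := by
  obtain ⟨S, hS, h⟩ := F.exists_max_image (surplus w p) hF
  exact ⟨S, mem_favourites.2 ⟨hS, h⟩⟩

theorem measurableSet_pick_favourites_eq {Ω : Type*} [MeasurableSpace Ω]
    {w : Ω → Finset (Fin m) → ℝ} (hw : ∀ S, Measurable fun ω => w ω S) (p : Fin m → ℝ)
    (F : Finset (Finset (Fin m))) (pick : Finset (Finset (Fin m)) → Finset (Fin m))
    (B : Finset (Fin m)) : MeasurableSet {ω | pick (favourites (w ω) p F) = B} := by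
  classical
  have hs : ∀ S, Measurable fun ω => surplus (w ω) p S := fun S => (hw S).sub_const _
  have hmem : ∀ S, MeasurableSet {ω | S ∈ favourites (w ω) p F} := by
    intro S
    simp only [mem_favourites]
    refine (MeasurableSet.const _).inter ?_
    have : {ω | ∀ S' ∈ F, surplus (w ω) p S' ≤ surplus (w ω) p S} =
        ⋂ S' ∈ F, {ω | surplus (w ω) p S' ≤ surplus (w ω) p S} := by
      ext; simp
    change MeasurableSet {ω | ∀ S' ∈ F, surplus (w ω) p S' ≤ surplus (w ω) p S}
    rw [this]
    exact Finset.measurableSet_biInter _ fun S' _ => measurableSet_le (hs S') (hs S)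
  have hfav : ∀ K : Finset (Finset (Fin m)), MeasurableSet {ω | favourites (w ω) p F = K} := by
    intro K
    have : {ω | favourites (w ω) p F = K} = ⋂ S, {ω | S ∈ favourites (w ω) p F ↔ S ∈ K} := by
      ext; simp only [Set.mem_iInter, Finset.ext_iff]; rfl
    rw [this]
    refine MeasurableSet.iInter fun S => ?_
    by_cases hS : S ∈ K
    · simpa [hS] using hmem S
    · simp only [hS, iff_false]
      exact (hmem S).compl
  have : {ω | pick (favourites (w ω) p F) = B} =
      ⋃ K : Finset (Finset (Fin m)), {ω | favourites (w ω) p F = K ∧ pick K = B} := by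
    ext ω; simp
  rw [this]
  exact MeasurableSet.iUnion fun K => (hfav K).inter (MeasurableSet.const _)

end Surplus

/-! ### The items left over in a sequential mechanism -/

section Remaining

variable {n m : ℕ} {T : Fin n → Fin m → Type*}
  (buy : ∀ i : Fin n, BidderType T i → Finset (Fin m) → Finset (Fin m))

theorem remaining_succ (t : Profile T) (i : Fin n) :
    remaining buy t (i + 1) = remaining buy t i \ buy i (t i) (remaining buy t i) := by
  simp [remaining]

theorem remaining_antitone (t : Profile T) : Antitone (remaining buy t) := by
  refine antitone_nat_of_succ_le fun k => ?_
  rw [remaining]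
  split_ifs
  · exact Finset.sdiff_subset
  · exact le_rfl

theorem remaining_update (t : Profile T) (i : Fin n) (x : BidderType T i) {k : ℕ} (hk : k ≤ i) :
    remaining buy (Function.update t i x) k = remaining buy t k := by
  induction k with
  | zero => rfl
  | succ k ih =>
    have hkn : k < n := by omega
    have h1 := remaining_succ buy (Function.update t i x) ⟨k, hkn⟩
    have h2 := remaining_succ buy t ⟨k, hkn⟩
    have hne : (⟨k, hkn⟩ : Fin n) ≠ i := by rw [Fin.ne_iff_vne]; simp only; omega
    simp only [Function.update_of_ne hne, ih (by omega)] at h1 h2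
    rw [h1, h2]

/-- An item is gone only if an earlier bidder bought it. -/
theorem exists_mem_buy_of_notMem_remaining (t : Profile T) {j : Fin m} {k : ℕ}
    (h : j ∉ remaining buy t k) :
    ∃ i : Fin n, (i : ℕ) < k ∧ j ∈ remaining buy t i ∧ j ∈ buy i (t i) (remaining buy t i) := by
  induction k with
  | zero => simp [remaining] at h
  | succ k ih =>
    by_cases hj : j ∈ remaining buy t k
    · by_cases hkn : k < n
      · have := remaining_succ buy t ⟨k, hkn⟩
        simp only at this
        rw [this, Finset.mem_sdiff, not_and_not_right] at h
        exact ⟨⟨k, hkn⟩, by simp, hj, h hj⟩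
      · rw [remaining, dif_neg hkn] at h
        exact absurd hj h
    · obtain ⟨i, hi, h'⟩ := ih hj
      exact ⟨i, by omega, h'⟩

variable [∀ i j, MeasurableSpace (T i j)]

theorem measurableSet_remaining_eq
    (hbuy : ∀ i A B, MeasurableSet {t : BidderType T i | buy i t A = B}) (k : ℕ)
    (A : Finset (Fin m)) : MeasurableSet {t : Profile T | remaining buy t k = A} := by
  induction k generalizing A with
  | zero => exact MeasurableSet.const (Finset.univ = A)
  | succ k ih =>
    by_cases hkn : k < n
    · have : {t : Profile T | remaining buy t (k + 1) = A} =
          ⋃ C : Finset (Fin m), ⋃ B : Finset (Fin m), {t | (remaining buy t k = C ∧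
            buy ⟨k, hkn⟩ (t ⟨k, hkn⟩) C = B) ∧ C \ B = A} := by
        ext t
        have := remaining_succ buy t ⟨k, hkn⟩
        simp only at this
        simp [this]
      rw [this]
      exact MeasurableSet.iUnion fun C => MeasurableSet.iUnion fun B =>
        ((ih C).inter (measurable_pi_apply _ (hbuy ⟨k, hkn⟩ C B))).inter (MeasurableSet.const _)
    · simpa [remaining, hkn] using ih A

theorem measurableSet_remaining
    (hbuy : ∀ i A B, MeasurableSet {t : BidderType T i | buy i t A = B}) (k : ℕ)
    (p : Finset (Fin m) → Prop) : MeasurableSet {t : Profile T | p (remaining buy t k)} := by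
  have : {t : Profile T | p (remaining buy t k)} =
      ⋃ C : Finset (Fin m), {t | remaining buy t k = C ∧ p C} := by
    ext t; simp
  rw [this]
  exact MeasurableSet.iUnion fun C =>
    (measurableSet_remaining_eq buy hbuy k C).inter (MeasurableSet.const _)

end Remaining

/-! ### Lower bounds on the revenue of rationed posted price mechanisms -/

section Independence

variable {n m : ℕ} {T : Fin n → Fin m → Type*} [∀ i j, MeasurableSpace (T i j)]
  {v : Valuation T}

/-- Without externalities the value of item `j` is a function of the `j`-th coordinate of the
type. -/
theorem exists_singleton_value_eq (hv : SubadditiveOverItems v) (i : Fin n)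
    (hne : ∀ j, Nonempty (T i j)) :
    ∃ g : ∀ j, T i j → ℝ, (∀ j, Measurable (g j)) ∧ ∀ t j, v i t {j} = g j (t j) := by
  let t₀ : BidderType T i := fun j => (hne j).some
  refine ⟨fun j x => v i (Function.update t₀ j x) {j},
    fun j => (hv.measurable i {j}).comp (measurable_update t₀), fun t j => ?_⟩
  exact hv.noExternalities i _ _ _ fun k hk => by
    rw [Finset.mem_singleton.1 hk, Function.update_self]

variable (D : ∀ i j, Measure (T i j)) [∀ i j, IsProbabilityMeasure (D i j)]

theorem measureReal_value_mem_and (hv : SubadditiveOverItems v) (i : Fin n) (j : Fin m)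
    {I : Set ℝ} (hI : MeasurableSet I) {F : Set (BidderType T i)} (hF : MeasurableSet F)
    (hFj : ∀ t x, Function.update t j x ∈ F ↔ t ∈ F) :
    (bidderDist D i).real {t | t ∈ F ∧ v i t {j} ∈ I} =
      (bidderDist D i).real F * (bidderDist D i).real {t | v i t {j} ∈ I} := by
  obtain ⟨g, hg, hvg⟩ := exists_singleton_value_eq hv i fun j =>
    nonempty_of_isProbabilityMeasure (D i j)
  simp only [hvg]
  have h := measureReal_inter_of_update_invariant (D i) j (hg j hI) hF hFj
  have h' := measureReal_eval_preimage (D i) j (hg j hI)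
  unfold bidderDist
  rw [← h'] at h
  exact h

theorem measureReal_forall_value_le (hv : SubadditiveOverItems v) (i : Fin n) (p : Fin m → ℝ) :
    (bidderDist D i).real {t | ∀ j, v i t {j} ≤ p j} =
      ∏ j, (1 - (bidderDist D i).real {t | p j < v i t {j}}) := by
  obtain ⟨g, hg, hvg⟩ := exists_singleton_value_eq hv i fun j =>
    nonempty_of_isProbabilityMeasure (D i j)
  have h1 : ∀ j, 1 - (bidderDist D i).real {t | p j < v i t {j}} =
      (D i j).real {x | g j x ≤ p j} := by
    intro j
    have hm : MeasurableSet {t | p j < v i t {j}} := hv.measurable i {j} measurableSet_Ioi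
    have hmg : MeasurableSet {x | g j x ≤ p j} := hg j measurableSet_Iic
    rw [← probReal_compl_eq_one_sub hm, ← measureReal_eval_preimage (D i) j hmg]
    unfold bidderDist
    congr 1
    ext t
    simp [hvg]
  simp only [h1]
  have e : {t | ∀ j, v i t {j} ≤ p j} = Set.univ.pi fun j => {x | g j x ≤ p j} := by
    ext t
    simp [hvg]
  rw [e, bidderDist, measureReal_def, Measure.pi_pi, ENNReal.toReal_prod]
  rfl

end Independence

section Rationed

variable {n m : ℕ} {T : Fin n → Fin m → Type*}

theorem rspmBuy_spec (tb : TieBreaking n m) (v : Valuation T) (p : Fin n → Fin m → ℝ) (i : Fin n)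
    (t : BidderType T i) (A : Finset (Fin m)) :
    rspmBuy tb v p i t A ⊆ A ∧ (rspmBuy tb v p i t A).card ≤ 1 ∧ ∀ S ⊆ A, S.card ≤ 1 →
      surplus (v i t) (p i) S ≤ surplus (v i t) (p i) (rspmBuy tb v p i t A) := by
  have hne : (A.powerset.filter fun S => S.card ≤ 1).Nonempty := ⟨∅, by simp⟩
  obtain ⟨h1, h2⟩ := mem_favourites.1 (tb.pick_mem i _ (favourites_nonempty (v i t) (p i) hne))
  rw [Finset.mem_filter, Finset.mem_powerset] at h1
  exact ⟨h1.1, h1.2, fun S hS hc => h2 S (by simp [hS, hc])⟩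

theorem rspmBuy_eq_of_mem (tb : TieBreaking n m) (v : Valuation T) (p : Fin n → Fin m → ℝ)
    (i : Fin n) (t : BidderType T i) (A : Finset (Fin m)) {j : Fin m}
    (hj : j ∈ rspmBuy tb v p i t A) : rspmBuy tb v p i t A = {j} :=
  Finset.eq_singleton_iff_unique_mem.2 ⟨hj, fun _ hk =>
    Finset.card_le_one.1 (rspmBuy_spec tb v p i t A).2.1 _ hk _ hj⟩

variable [∀ i j, MeasurableSpace (T i j)] {tb : TieBreaking n m} {v : Valuation T}

theorem measurableSet_rspmBuy_eq (tb : TieBreaking n m) (hv : SubadditiveOverItems v)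
    (p : Fin n → Fin m → ℝ) (i : Fin n) (A B : Finset (Fin m)) :
    MeasurableSet {t : BidderType T i | rspmBuy tb v p i t A = B} :=
  measurableSet_pick_favourites_eq (fun S => hv.measurable i S) (p i) _ (tb.pick i) B

theorem price_le_value_of_mem_rspmBuy (hv : SubadditiveOverItems v) (p : Fin n → Fin m → ℝ)
    (i : Fin n) (t : BidderType T i) (A : Finset (Fin m)) {j : Fin m}
    (hj : j ∈ rspmBuy tb v p i t A) : p i j ≤ v i t {j} := by
  have h := (rspmBuy_spec tb v p i t A).2.2 ∅ (Finset.empty_subset A) (by simp)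
  rw [rspmBuy_eq_of_mem tb v p i t A hj, surplus_empty (hv.empty i t)] at h
  simpa [surplus] using h

theorem rspmBuy_nonempty (hv : SubadditiveOverItems v) (p : Fin n → Fin m → ℝ)
    (i : Fin n) (t : BidderType T i) {A : Finset (Fin m)} {j : Fin m} (hj : j ∈ A)
    (hp : p i j < v i t {j}) : (rspmBuy tb v p i t A).Nonempty := by
  rw [Finset.nonempty_iff_ne_empty]
  intro he
  have h := (rspmBuy_spec tb v p i t A).2.2 {j} (by simpa using hj) (by simp)
  rw [he, surplus_empty (hv.empty i t)] at h
  simp only [surplus, Finset.sum_singleton] at h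
  linarith

variable (D : ∀ i j, Measure (T i j)) [∀ i j, IsProbabilityMeasure (D i j)]

theorem one_sub_le_measureReal_mem_remaining (hv : SubadditiveOverItems v)
    (p : Fin n → Fin m → ℝ) (i : Fin n) (j : Fin m) {b : ℝ}
    (hb : ∑ k ∈ Finset.univ.erase i, tailProb D v k j (p k j) ≤ b) :
    1 - b ≤ (profileDist D).real {t | j ∈ remaining (rspmBuy tb v p) t i} := by
  have hm : MeasurableSet {t : Profile T | j ∈ remaining (rspmBuy tb v p) t i} :=
    measurableSet_remaining _ (measurableSet_rspmBuy_eq tb hv p) i (fun A => j ∈ A)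
  have hsub : {t : Profile T | j ∈ remaining (rspmBuy tb v p) t i}ᶜ ⊆
      ⋃ k ∈ Finset.univ.erase i, {t | p k j ≤ v k (t k) {j}} := by
    intro t ht
    obtain ⟨k, hk, -, hjk⟩ := exists_mem_buy_of_notMem_remaining _ t ht
    have hne : k ≠ i := by rintro rfl; exact lt_irrefl _ hk
    exact Set.mem_biUnion (Finset.mem_coe.2 (Finset.mem_erase.2 ⟨hne, Finset.mem_univ k⟩))
      (price_le_value_of_mem_rspmBuy hv p k (t k) _ hjk)
  have h1 : (profileDist D).real {t : Profile T | j ∈ remaining (rspmBuy tb v p) t i}ᶜ ≤ b := by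
    refine (measureReal_mono hsub (measure_ne_top _ _)).trans
      ((measureReal_biUnion_finset_le _ _).trans
      (le_trans (Finset.sum_le_sum fun k _ => ?_) hb))
    exact (measureReal_eval_preimage (fun i => Measure.pi (D i)) k
      (E := {x | p k j ≤ v k x {j}}) (hv.measurable k {j} measurableSet_Ici)).le
  rw [probReal_compl_eq_one_sub hm] at h1
  linarith

/-- If bidder `i` pays at least `r i j` whenever her type lies in `E i j` and item `j` is
available, and every item is available to her with probability at least `1 - b`, then the revenue
is at least `(1 - b) ∑ r i j Pr[E i j]`: the availability of items does not depend on her type. -/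
theorem le_PostRev_of_events (hv : SubadditiveOverItems v) {p r : Fin n → Fin m → ℝ}
    (hp : ∀ i j, 0 ≤ p i j) (hr : ∀ i j, 0 ≤ r i j) {b : ℝ}
    (hb : ∀ i j, ∑ k ∈ Finset.univ.erase i, tailProb D v k j (p k j) ≤ b)
    {E : ∀ i : Fin n, Fin m → Set (BidderType T i)} (hE : ∀ i j, MeasurableSet (E i j))
    (hdisj : ∀ i t j k, t ∈ E i j → t ∈ E i k → j = k)
    (hpay : ∀ i j, ∀ t ∈ E i j, ∀ A, j ∈ A → r i j ≤ ∑ k ∈ rspmBuy tb v p i t A, p i k) :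
    ENNReal.ofReal ((1 - b) * ∑ i, ∑ j, r i j * (bidderDist D i).real (E i j)) ≤
      PostRev D tb v := by
  classical
  set avail : Profile T → Fin n → Finset (Fin m) := fun t i => remaining (rspmBuy tb v p) t i
    with havail
  have hFm : ∀ i j, MeasurableSet {t | j ∈ avail t i} := fun i j =>
    measurableSet_remaining _ (measurableSet_rspmBuy_eq tb hv p) i (fun A => j ∈ A)
  have hEFm : ∀ i j, MeasurableSet {t | j ∈ avail t i ∧ t i ∈ E i j} := fun i j =>
    (hFm i j).inter (measurable_pi_apply i (hE i j))
  set g : Profile T → ℝ := fun t => ∑ i, ∑ j,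
    r i j * Set.indicator {t | j ∈ avail t i ∧ t i ∈ E i j} 1 t with hg
  have hgint : ∀ i j, Integrable
      (fun t => r i j * Set.indicator {t | j ∈ avail t i ∧ t i ∈ E i j} (1 : Profile T → ℝ) t)
      (profileDist D) := fun i j =>
    ((integrable_const (1 : ℝ)).indicator (hEFm i j)).const_mul _
  have hgi : Integrable g (profileDist D) :=
    integrable_finsetSum _ fun i _ => integrable_finsetSum _ fun j _ => hgint i j
  have hg0 : ∀ t, 0 ≤ g t := fun t => Finset.sum_nonneg fun i _ => Finset.sum_nonneg fun j _ =>
    mul_nonneg (hr i j) (Set.indicator_nonneg (fun _ _ => zero_le_one) t)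
  have hint : (1 - b) * ∑ i, ∑ j, r i j * (bidderDist D i).real (E i j) ≤
      ∫ t, g t ∂(profileDist D) := by
    rw [integral_finsetSum _ fun i _ => integrable_finsetSum _ fun j _ => hgint i j,
      Finset.mul_sum]
    refine Finset.sum_le_sum fun i _ => ?_
    rw [integral_finsetSum _ fun j _ => hgint i j, Finset.mul_sum]
    refine Finset.sum_le_sum fun j _ => ?_
    rw [integral_const_mul, integral_indicator_one (hEFm i j)]
    have h := measureReal_inter_of_update_invariant (fun i => Measure.pi (D i)) i (hE i j)
      (hFm i j) (fun t x => by
        simp only [Set.mem_ofPred_eq, havail, remaining_update _ t i x le_rfl])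
    have h' : (profileDist D).real {t | j ∈ avail t i ∧ t i ∈ E i j} =
      (profileDist D).real {t | j ∈ avail t i} * (bidderDist D i).real (E i j) := h
    rw [h']
    have h1 := one_sub_le_measureReal_mem_remaining D (tb := tb) hv p i j (hb i j)
    have h2 : 0 ≤ r i j * (bidderDist D i).real (E i j) := mul_nonneg (hr i j) measureReal_nonneg
    nlinarith [mul_le_mul_of_nonneg_right h1 h2]
  have hle : ∀ t, g t ≤ ∑ i : Fin n, ∑ j ∈ rspmBuy tb v p i (t i) (avail t i), p i j := by
    intro t
    refine Finset.sum_le_sum fun i _ => ?_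
    have hpay0 : 0 ≤ ∑ j ∈ rspmBuy tb v p i (t i) (avail t i), p i j :=
      Finset.sum_nonneg fun j _ => hp i j
    by_cases h : ∃ j, t i ∈ E i j
    · obtain ⟨j, hj⟩ := h
      rw [Finset.sum_eq_single j]
      · by_cases ha : j ∈ avail t i
        · simpa [Set.indicator, ha, hj] using hpay i j (t i) hj _ ha
        · simpa [Set.indicator, ha] using hpay0
      · intro k _ hk
        have : t i ∉ E i k := fun h => hk (hdisj i (t i) k j h hj)
        simp [Set.indicator, this]
      · simp
    · push Not at h
      simpa [Set.indicator, h] using hpay0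
  calc ENNReal.ofReal ((1 - b) * ∑ i, ∑ j, r i j * (bidderDist D i).real (E i j))
      ≤ ENNReal.ofReal (∫ t, g t ∂(profileDist D)) := ENNReal.ofReal_le_ofReal hint
    _ = ∫⁻ t, ENNReal.ofReal (g t) ∂(profileDist D) :=
        ofReal_integral_eq_lintegral_ofReal hgi (.of_forall hg0)
    _ ≤ rspmRevenue D tb v p :=
        lintegral_mono fun t => ENNReal.ofReal_le_ofReal (hle t)
    _ ≤ PostRev D tb v :=
        le_iSup (fun P : Fin n → Fin m → ℝ≥0 => rspmRevenue D tb v fun i j => (P i j : ℝ))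
          fun i j => ⟨p i j, hp i j⟩

theorem le_toReal_PostRev_of_ofReal_le {x : ℝ} (hR : PostRev D tb v ≠ ∞)
    (h : ENNReal.ofReal x ≤ PostRev D tb v) : x ≤ (PostRev D tb v).toReal :=
  (ENNReal.ofReal_le_iff_le_toReal hR).1 h

/-- A bidder who values `j` above its price, and every other item below its price, buys `j` whenever
it is available. Values of different items are independent. -/
theorem le_PostRev_of_unique_item (hv : SubadditiveOverItems v) (hR : PostRev D tb v ≠ ∞)
    {p : Fin n → Fin m → ℝ} (hp : ∀ i j, 0 ≤ p i j) {b s : ℝ} (hb1 : b ≤ 1)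
    (hb : ∀ i j, ∑ k ∈ Finset.univ.erase i, tailProb D v k j (p k j) ≤ b)
    (hs : ∀ i, ∑ j, tailProb D v i j (p i j) ≤ s) :
    (1 - b) * ((1 - s) * ∑ i, ∑ j, p i j * (bidderDist D i).real {t | p i j < v i t {j}}) ≤
      (PostRev D tb v).toReal := by
  have hFm : ∀ i j, MeasurableSet {t | ∀ k, k ≠ j → v i t {k} < p i k} := by
    intro i j
    have : {t | ∀ k, k ≠ j → v i t {k} < p i k} =
        ⋂ k, {t | k ≠ j → v i t {k} < p i k} := by ext; simp
    rw [this]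
    refine MeasurableSet.iInter fun k => ?_
    by_cases hk : k = j
    · simp [hk]
    · simp only [ne_eq, hk, not_false_eq_true, true_imp_iff]
      exact hv.measurable i {k} measurableSet_Iio
  set E : ∀ i : Fin n, Fin m → Set (BidderType T i) := fun i j =>
    {t | t ∈ {t | ∀ k, k ≠ j → v i t {k} < p i k} ∧ v i t {j} ∈ Set.Ioi (p i j)} with hEdef
  have hEm : ∀ i j, MeasurableSet (E i j) := fun i j =>
    (hFm i j).inter (hv.measurable i {j} measurableSet_Ioi)
  have hprob : ∀ i j, (1 - s) * (bidderDist D i).real {t | p i j < v i t {j}} ≤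
      (bidderDist D i).real (E i j) := by
    intro i j
    rw [hEdef, measureReal_value_mem_and D hv i j measurableSet_Ioi (hFm i j)]
    · refine mul_le_mul_of_nonneg_right ?_ measureReal_nonneg
      have hsub : {t | ∀ k, k ≠ j → v i t {k} < p i k}ᶜ ⊆
          ⋃ k ∈ Finset.univ, {t | p i k ≤ v i t {k}} := by
        intro t ht
        simp only [Set.mem_compl_iff, Set.mem_ofPred_eq, not_forall, not_lt] at ht
        obtain ⟨k, _, hk⟩ := ht
        exact Set.mem_biUnion (Finset.mem_coe.2 (Finset.mem_univ k)) hk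
      have h1 := (measureReal_mono (μ := bidderDist D i) hsub (measure_ne_top _ _)).trans
        ((measureReal_biUnion_finset_le _ _).trans (hs i))
      rw [probReal_compl_eq_one_sub (hFm i j)] at h1
      linarith
    · intro t x
      simp only [Set.mem_ofPred_eq]
      refine forall_congr' fun k => imp_congr_right fun hk => ?_
      rw [hv.noExternalities i (Function.update t j x) t {k} fun l hl => by
        rw [Finset.mem_singleton.1 hl, Function.update_of_ne hk]]
  have h := le_toReal_PostRev_of_ofReal_le D hR
    (le_PostRev_of_events D (tb := tb) hv hp hp hb hEm ?_ ?_)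
  · refine le_trans (mul_le_mul_of_nonneg_left ?_ (sub_nonneg.2 hb1)) h
    simp only [Finset.mul_sum]
    refine Finset.sum_le_sum fun i _ => Finset.sum_le_sum fun j _ => ?_
    nlinarith [mul_le_mul_of_nonneg_left (hprob i j) (hp i j)]
  · intro i t j k hj hk
    by_contra hne
    exact lt_asymm (hj.1 k (Ne.symm hne)) hk.2
  · intro i j t ht A hjA
    obtain ⟨k, hk⟩ := rspmBuy_nonempty (tb := tb) hv p i t hjA ht.2
    have hkj : k = j := by
      by_contra hne
      exact absurd (ht.1 k hne) (price_le_value_of_mem_rspmBuy hv p i t A hk).not_gt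
    subst hkj
    rw [rspmBuy_eq_of_mem tb v p i t A hk, Finset.sum_singleton]

/-- A bidder buys some item whenever the first item that she values above its price is available. -/
theorem le_PostRev_of_first_item (hv : SubadditiveOverItems v) (hR : PostRev D tb v ≠ ∞)
    {p : Fin n → Fin m → ℝ} {r : Fin n → ℝ} (hr : ∀ i, 0 ≤ r i) (hrp : ∀ i j, r i ≤ p i j) {b : ℝ}
    (hb : ∀ i j, ∑ k ∈ Finset.univ.erase i, tailProb D v k j (p k j) ≤ b) :
    (1 - b) * ∑ i, r i * (1 - ∏ j, (1 - (bidderDist D i).real {t | p i j < v i t {j}})) ≤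
      (PostRev D tb v).toReal := by
  have hp : ∀ i j, 0 ≤ p i j := fun i j => (hr i).trans (hrp i j)
  set E : ∀ i : Fin n, Fin m → Set (BidderType T i) := fun i j =>
    {t | p i j < v i t {j}} ∩ ⋂ k ∈ Finset.univ.filter (· < j), {t | v i t {k} ≤ p i k} with hEdef
  have hEm : ∀ i j, MeasurableSet (E i j) := fun i j =>
    (hv.measurable i {j} measurableSet_Ioi).inter
      (Finset.measurableSet_biInter _ fun k _ => hv.measurable i {k} measurableSet_Iic)
  have hmem : ∀ i j t, t ∈ E i j ↔ p i j < v i t {j} ∧ ∀ k < j, v i t {k} ≤ p i k := by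
    intro i j t
    simp [hEdef]
  have hdisj : ∀ i t j k, t ∈ E i j → t ∈ E i k → j = k := by
    intro i t j k hj hk
    rw [hmem] at hj hk
    rcases lt_trichotomy j k with h | h | h
    · exact absurd (hk.2 j h) hj.1.not_ge
    · exact h
    · exact absurd (hj.2 k h) hk.1.not_ge
  have hsum : ∀ i, ∑ j, (bidderDist D i).real (E i j) =
      1 - ∏ j, (1 - (bidderDist D i).real {t | p i j < v i t {j}}) := by
    intro i
    have hm : MeasurableSet {t | ∀ j, v i t {j} ≤ p i j} := by
      have : {t | ∀ j, v i t {j} ≤ p i j} = ⋂ j, {t | v i t {j} ≤ p i j} := by ext; simp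
      rw [this]
      exact MeasurableSet.iInter fun j => hv.measurable i {j} measurableSet_Iic
    rw [← measureReal_forall_value_le D hv i (p i), ← probReal_compl_eq_one_sub hm,
      ← measureReal_biUnion_finset (fun j _ k _ hne => Set.disjoint_left.2 fun t hj hk =>
        hne (hdisj i t j k hj hk)) fun j _ => hEm i j]
    congr 1
    ext t
    simp only [Set.mem_iUnion, Finset.mem_univ, exists_true_left, hmem, Set.mem_compl_iff,
      Set.mem_ofPred_eq, not_forall, not_le]
    refine ⟨fun ⟨j, hj⟩ => ⟨j, hj.1⟩, fun h => ?_⟩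
    have hne : (Finset.univ.filter fun j => p i j < v i t {j}).Nonempty := by
      obtain ⟨j, hj⟩ := h
      exact ⟨j, by simpa using hj⟩
    refine ⟨_, (Finset.mem_filter.1 (Finset.min'_mem _ hne)).2, fun k hk => ?_⟩
    by_contra! hlt
    exact absurd (Finset.min'_le _ k (by simpa using hlt)) hk.not_ge
  have h := le_toReal_PostRev_of_ofReal_le D hR
    (le_PostRev_of_events D (tb := tb) (r := fun i _ => r i) hv hp (fun i _ => hr i) hb hEm
      hdisj ?_)
  · simpa only [← Finset.mul_sum, hsum] using h
  · intro i j t ht A hjA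
    obtain ⟨k, hk⟩ := rspmBuy_nonempty (tb := tb) hv p i t hjA ((hmem i j t).1 ht).1
    rw [rspmBuy_eq_of_mem tb v p i t A hk, Finset.sum_singleton]
    exact hrp i k

end Rationed

/-! ### Prices at which the tail probabilities sum up to `1 / 2` -/

section Limits

open Filter Topology

variable {n m : ℕ}

/-- Prices lowered by `1 / (N + 1)`: a bidder whose value equals the original price strictly
prefers to buy at the lowered price, whatever the tie-breaking rule. -/
noncomputable def loweredPrice (P : Fin n → Fin m → ℝ) (N : ℕ) (i : Fin n) (j : Fin m) : ℝ :=
  max (P i j - 1 / ((N : ℝ) + 1)) 0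

theorem loweredPrice_nonneg (P : Fin n → Fin m → ℝ) (N : ℕ) (i : Fin n) (j : Fin m) :
    0 ≤ loweredPrice P N i j := le_max_right _ _

theorem loweredPrice_le {P : Fin n → Fin m → ℝ} (hP : ∀ i j, 0 ≤ P i j) (N : ℕ) (i : Fin n)
    (j : Fin m) : loweredPrice P N i j ≤ P i j :=
  max_le (by linarith [(by positivity : 0 ≤ 1 / ((N : ℝ) + 1))]) (hP i j)

theorem loweredPrice_lt {P : Fin n → Fin m → ℝ} {N : ℕ} {i : Fin n} {j : Fin m}
    (h : 0 < P i j) : loweredPrice P N i j < P i j :=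
  max_lt (by linarith [(by positivity : 0 < 1 / ((N : ℝ) + 1))]) h

theorem tendsto_loweredPrice {P : Fin n → Fin m → ℝ} (hP : ∀ i j, 0 ≤ P i j) (i : Fin n)
    (j : Fin m) : Tendsto (fun N => loweredPrice P N i j) atTop (𝓝 (P i j)) := by
  have h := (tendsto_sub_const_div (P i j) 1).max (tendsto_const_nhds (x := (0 : ℝ)))
  simpa [loweredPrice, max_eq_left (hP i j)] using h

variable {T : Fin n → Fin m → Type*} [∀ i j, MeasurableSpace (T i j)]
  (D : ∀ i j, Measure (T i j)) [∀ i j, IsProbabilityMeasure (D i j)]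
  {tb : TieBreaking n m} {v : Valuation T}

/-- The total increase of the tail probabilities when the prices are lowered. -/
noncomputable def tailIncrease (v : Valuation T) (P : Fin n → Fin m → ℝ) (N : ℕ) : ℝ :=
  ∑ i, ∑ j, (tailProb D v i j (loweredPrice P N i j) - tailProb D v i j (P i j))

theorem tendsto_tailIncrease (hv : SubadditiveOverItems v) {P : Fin n → Fin m → ℝ}
    (hP : ∀ i j, 0 ≤ P i j) : Tendsto (tailIncrease D v P) atTop (𝓝 0) := by
  have h : Tendsto (tailIncrease D v P) atTop
      (𝓝 (∑ i, ∑ j, (tailProb D v i j (P i j) - tailProb D v i j (P i j)))) :=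
    tendsto_finsetSum _ fun i _ => tendsto_finsetSum _ fun j _ =>
      (tendsto_tailProb D hv i j (fun N => loweredPrice_le hP N i j)
        (tendsto_loweredPrice hP i j)).sub_const _
  simpa using h

theorem sum_tailProb_loweredPrice_le_add {P : Fin n → Fin m → ℝ} (hP : ∀ i j, 0 ≤ P i j)
    (N : ℕ) (i : Fin n) :
    ∑ j, tailProb D v i j (loweredPrice P N i j) ≤
      ∑ j, tailProb D v i j (P i j) + tailIncrease D v P N := by
  have h0 : ∀ i j, 0 ≤ tailProb D v i j (loweredPrice P N i j) - tailProb D v i j (P i j) :=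
    fun i j => sub_nonneg.2 (tailProb_antitone D v i j (loweredPrice_le hP N i j))
  have h : ∑ j, (tailProb D v i j (loweredPrice P N i j) - tailProb D v i j (P i j)) ≤
      tailIncrease D v P N :=
    Finset.single_le_sum (f := fun i => ∑ j, (tailProb D v i j (loweredPrice P N i j) -
      tailProb D v i j (P i j))) (fun i _ => Finset.sum_nonneg fun j _ => h0 i j)
      (Finset.mem_univ i)
  rw [Finset.sum_sub_distrib] at h
  linarith

theorem sum_erase_tailProb_loweredPrice_le_add {P : Fin n → Fin m → ℝ} (hP : ∀ i j, 0 ≤ P i j)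
    (N : ℕ) (i : Fin n) (j : Fin m) :
    ∑ k ∈ Finset.univ.erase i, tailProb D v k j (loweredPrice P N k j) ≤
      ∑ k ∈ Finset.univ.erase i, tailProb D v k j (P k j) + tailIncrease D v P N := by
  have h0 : ∀ i j, 0 ≤ tailProb D v i j (loweredPrice P N i j) - tailProb D v i j (P i j) :=
    fun i j => sub_nonneg.2 (tailProb_antitone D v i j (loweredPrice_le hP N i j))
  have h : ∑ k ∈ Finset.univ.erase i,
      (tailProb D v k j (loweredPrice P N k j) - tailProb D v k j (P k j)) ≤
      tailIncrease D v P N :=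
    (Finset.sum_le_sum_of_subset_of_nonneg (Finset.erase_subset _ _) fun k _ _ => h0 k j).trans
      (Finset.sum_le_sum fun k _ => Finset.single_le_sum (f := fun j =>
        tailProb D v k j (loweredPrice P N k j) - tailProb D v k j (P k j))
        (fun j _ => h0 k j) (Finset.mem_univ j))
  rw [Finset.sum_sub_distrib] at h
  linarith

theorem tailProb_le_measureReal_loweredPrice_lt {P : Fin n → Fin m → ℝ} (N : ℕ) {i : Fin n}
    {j : Fin m} (h : 0 < P i j) :
    tailProb D v i j (P i j) ≤ (bidderDist D i).real {t | loweredPrice P N i j < v i t {j}} :=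
  measureReal_mono fun _ ht => (loweredPrice_lt h).trans_le ht

/-- If the tail probabilities of each bidder at her prices sum up to at most `1 / 2`, then all other
items are worth less to her than their prices with probability at least `1 / 2`, and each item is
available with probability at least `1 - b`. -/
theorem sum_price_mul_tailProb_le (hv : SubadditiveOverItems v) (hR : PostRev D tb v ≠ ∞)
    {P : Fin n → Fin m → ℝ} (hP : ∀ i j, 0 ≤ P i j) {b : ℝ} (hb1 : b < 1)
    (hb : ∀ i j, ∑ k ∈ Finset.univ.erase i, tailProb D v k j (P k j) ≤ b)
    (hs : ∀ i, ∑ j, tailProb D v i j (P i j) ≤ 1 / 2) :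
    (1 - b) / 2 * ∑ i, ∑ j, P i j * tailProb D v i j (P i j) ≤ (PostRev D tb v).toReal := by
  have hη := tendsto_tailIncrease D hv hP
  have hlim : Tendsto (fun N => (1 - (b + tailIncrease D v P N)) *
      ((1 - (1 / 2 + tailIncrease D v P N)) *
        ∑ i, ∑ j, loweredPrice P N i j * tailProb D v i j (P i j))) atTop
      (𝓝 ((1 - (b + 0)) * ((1 - (1 / 2 + 0)) * ∑ i, ∑ j, P i j * tailProb D v i j (P i j)))) :=
    ((hη.const_add b).const_sub 1).mul (((hη.const_add _).const_sub 1).mul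
      (tendsto_finsetSum _ fun i _ => tendsto_finsetSum _ fun j _ =>
        (tendsto_loweredPrice hP i j).mul_const _))
  have e : (1 - b) / 2 * ∑ i, ∑ j, P i j * tailProb D v i j (P i j) =
      (1 - (b + 0)) * ((1 - (1 / 2 + 0)) * ∑ i, ∑ j, P i j * tailProb D v i j (P i j)) := by ring
  rw [e]
  refine le_of_tendsto hlim ?_
  filter_upwards [hη.eventually_lt_const (by linarith : 0 < 1 - b),
    hη.eventually_lt_const (by norm_num : (0 : ℝ) < 1 / 2)] with N hN hN'
  refine le_trans ?_ (le_PostRev_of_unique_item D (tb := tb) hv hR (loweredPrice_nonneg P N)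
    (by linarith : b + tailIncrease D v P N ≤ 1)
    (fun i j => (sum_erase_tailProb_loweredPrice_le_add D hP N i j).trans (by gcongr; exact hb i j))
    (fun i => (sum_tailProb_loweredPrice_le_add D hP N i).trans
      (by gcongr; exact hs i : _ ≤ 1 / 2 + tailIncrease D v P N)))
  refine mul_le_mul_of_nonneg_left (mul_le_mul_of_nonneg_left ?_ (by linarith)) (by linarith)
  refine Finset.sum_le_sum fun i _ => Finset.sum_le_sum fun j _ => ?_
  rcases (hP i j).eq_or_lt with h | h
  · have h0 : loweredPrice P N i j = 0 :=
      le_antisymm ((loweredPrice_le hP N i j).trans h.ge) (loweredPrice_nonneg P N i j)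
    simp [h0]
  · exact mul_le_mul_of_nonneg_left (tailProb_le_measureReal_loweredPrice_lt D N h)
      (loweredPrice_nonneg P N i j)

/-- Among independent events with total probability at least `1 / 2`, one occurs with probability
at least `1 - exp (-1 / 2) ≥ 1 / 4`. -/
theorem one_fourth_le_one_sub_prod {ι : Type*} (s : Finset ι) {q : ι → ℝ} (hq : ∀ j, q j ≤ 1)
    (h : 1 / 2 ≤ ∑ j ∈ s, q j) : 1 / 4 ≤ 1 - ∏ j ∈ s, (1 - q j) := by
  have h1 : ∏ j ∈ s, (1 - q j) ≤ Real.exp (-∑ j ∈ s, q j) := by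
    rw [← Finset.sum_neg_distrib, Real.exp_sum]
    exact Finset.prod_le_prod (fun j _ => sub_nonneg.2 (hq j)) fun j _ => by
      linarith [Real.add_one_le_exp (-q j)]
  have h2 : Real.exp (-∑ j ∈ s, q j) ≤ Real.exp (-(1 / 2)) := Real.exp_le_exp.2 (by linarith)
  have h3 : Real.exp (-(1 / 2)) * Real.exp (1 / 2) = 1 := by rw [← Real.exp_add]; simp
  have h4 := Real.add_one_le_exp (1 / 2 : ℝ)
  nlinarith [Real.exp_pos (-(1 / 2) : ℝ)]

/-- If the tail probabilities of bidder `i` at her prices sum up to at least `1 / 2`, then some item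
is worth its price to her with probability at least `1 / 4`, the first such item is available with
probability at least `1 - b`, and in that case she pays at least her smallest price. -/
theorem sum_le_of_half_le_sum_tailProb (hv : SubadditiveOverItems v) (hR : PostRev D tb v ≠ ∞)
    {P : Fin n → Fin m → ℝ} {r : Fin n → ℝ} (hr : ∀ i, 0 ≤ r i) (hrP : ∀ i j, r i ≤ P i j)
    {b : ℝ} (hb1 : b < 1)
    (hb : ∀ i j, ∑ k ∈ Finset.univ.erase i, tailProb D v k j (P k j) ≤ b)
    (hs : ∀ i, 0 < r i → 1 / 2 ≤ ∑ j, tailProb D v i j (P i j)) :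
    (1 - b) / 4 * ∑ i, r i ≤ (PostRev D tb v).toReal := by
  have hP : ∀ i j, 0 ≤ P i j := fun i j => (hr i).trans (hrP i j)
  have hη := tendsto_tailIncrease D hv hP
  have hrlim : ∀ i, Tendsto (fun N : ℕ => max (r i - 1 / ((N : ℝ) + 1)) 0) atTop (𝓝 (r i)) := by
    intro i
    have h := (tendsto_sub_const_div (r i) 1).max (tendsto_const_nhds (x := (0 : ℝ)))
    simpa [max_eq_left (hr i)] using h
  have hlim : Tendsto (fun N : ℕ => (1 - (b + tailIncrease D v P N)) *
      ∑ i, max (r i - 1 / ((N : ℝ) + 1)) 0 * (1 / 4)) atTop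
      (𝓝 ((1 - (b + 0)) * ∑ i, r i * (1 / 4))) :=
    ((hη.const_add b).const_sub 1).mul
      (tendsto_finsetSum _ fun i _ => (hrlim i).mul_const _)
  have e : (1 - b) / 4 * ∑ i, r i = (1 - (b + 0)) * ∑ i, r i * (1 / 4) := by
    rw [← Finset.sum_mul]; ring
  rw [e]
  refine le_of_tendsto hlim ?_
  filter_upwards [hη.eventually_lt_const (by linarith : 0 < 1 - b)] with N hN
  refine le_trans ?_ (le_PostRev_of_first_item D (tb := tb) hv hR (p := loweredPrice P N)
    (r := fun i => max (r i - 1 / ((N : ℝ) + 1)) 0) (fun i => le_max_right _ _)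
    (fun i j => max_le_max_right _ (by linarith [hrP i j]))
    (fun i j => (sum_erase_tailProb_loweredPrice_le_add D hP N i j).trans
      (by gcongr; exact hb i j : _ ≤ b + tailIncrease D v P N)))
  refine mul_le_mul_of_nonneg_left (Finset.sum_le_sum fun i _ => ?_) (by linarith)
  rcases (hr i).eq_or_lt with h | h
  · have h0 : max (r i - 1 / ((N : ℝ) + 1)) 0 = 0 := by
      rw [max_eq_right]
      linarith [(by positivity : 0 ≤ 1 / ((N : ℝ) + 1))]
    rw [h0, zero_mul, zero_mul]
  · refine mul_le_mul_of_nonneg_left (one_fourth_le_one_sub_prod _ (fun j => measureReal_le_one) ?_)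
      (le_max_right _ _)
    exact (hs i h).trans (Finset.sum_le_sum fun j _ =>
      tailProb_le_measureReal_loweredPrice_lt D N (h.trans_le (hrP i j)))

section Cutoffs

variable {b : ℝ} {β : Fin n → Fin m → ℝ}

theorem sum_erase_tailProb_le_of_le {P : Fin n → Fin m → ℝ} (hP : ∀ i j, β i j ≤ P i j)
    (hβ₁ : ∀ i j, ∑ k ∈ Finset.univ.erase i, tailProb D v k j (β k j) ≤ b) (i : Fin n)
    (j : Fin m) : ∑ k ∈ Finset.univ.erase i, tailProb D v k j (P k j) ≤ b :=
  (Finset.sum_le_sum fun k _ => tailProb_antitone D v k j (hP k j)).trans (hβ₁ i j)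

theorem sum_coreCutoff_le (hv : SubadditiveOverItems v) (hR : PostRev D tb v ≠ ∞) (hb1 : b < 1)
    (hβ : ∀ i j, 0 ≤ β i j)
    (hβ₁ : ∀ i j, ∑ k ∈ Finset.univ.erase i, tailProb D v k j (β k j) ≤ b) :
    (1 - b) / 4 * ∑ i, coreCutoff D v β i ≤ (PostRev D tb v).toReal :=
  sum_le_of_half_le_sum_tailProb D hv hR (P := fun i j => β i j + coreCutoff D v β i)
    (coreCutoff_nonneg D v β) (fun i j => by linarith [hβ i j]) hb1
    (sum_erase_tailProb_le_of_le D (fun i j => by linarith [coreCutoff_nonneg D v β i]) hβ₁)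
    (half_le_sum_tailProb_coreCutoff D hv β)

theorem sum_feeCutoff_le (hv : SubadditiveOverItems v) (hR : PostRev D tb v ≠ ∞) (hb1 : b < 1)
    (hβ₁ : ∀ i j, ∑ k ∈ Finset.univ.erase i, tailProb D v k j (β k j) ≤ b)
    {Q : Fin m → ℝ} (hQ : ∀ j, 0 ≤ Q j) :
    (1 - b) / 4 * ∑ i, feeCutoff D v β Q i ≤ (PostRev D tb v).toReal :=
  sum_le_of_half_le_sum_tailProb D hv hR
    (P := fun i j => max (β i j) (Q j + feeCutoff D v β Q i))
    (feeCutoff_nonneg D v β Q)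
    (fun i j => (by linarith [hQ j] : _ ≤ Q j + feeCutoff D v β Q i).trans (le_max_right _ _)) hb1
    (sum_erase_tailProb_le_of_le D (fun i j => le_max_left _ _) hβ₁)
    (half_le_sum_tailProb_feeCutoff D hv β Q)

end Cutoffs

end Limits

/-! ### Interim allocations -/

section Interim

variable {n m : ℕ} {T : Fin n → Fin m → Type*} [∀ i j, MeasurableSpace (T i j)]
  (D : ∀ i j, Measure (T i j)) [∀ i j, IsProbabilityMeasure (D i j)] (X : AllocationRule T)

theorem AllocationRule.sum_prob_le_one (t : Profile T) (s : Finset (Fin n → Finset (Fin m))) :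
    ∑ a ∈ s, X.prob t a ≤ 1 := by
  rw [← X.sum_eq_one t]
  exact Finset.sum_le_sum_of_subset_of_nonneg (Finset.subset_univ s) fun a _ _ => X.nonneg t a

theorem AllocationRule.measurable_sum_prob (s : Finset (Fin n → Finset (Fin m))) :
    Measurable fun t => ∑ a ∈ s, X.prob t a :=
  Finset.measurable_sum _ fun a _ => X.measurable a

theorem AllocationRule.interim_nonneg (i : Fin n) (S : Finset (Fin m)) (ti : BidderType T i) :
    0 ≤ X.interim D i S ti :=
  integral_nonneg fun _ => Finset.sum_nonneg fun a _ => X.nonneg _ a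

theorem AllocationRule.measurable_interim (i : Fin n) (S : Finset (Fin m)) :
    Measurable (X.interim D i S) := by
  have hu : Measurable fun z : BidderType T i × Profile T => Function.update z.2 i z.1 :=
    (measurable_update' (X := fun i => BidderType T i)).comp measurable_swap
  have h : Measurable fun z : BidderType T i × Profile T =>
      ∑ a : Fin n → Finset (Fin m) with a i = S, X.prob (Function.update z.2 i z.1) a :=
    (X.measurable_sum_prob _).comp hu
  exact h.stronglyMeasurable.integral_prod_right' (ν := profileDist D) |>.measurable

theorem AllocationRule.sum_interim (i : Fin n) (ti : BidderType T i) :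
    ∑ S, X.interim D i S ti = 1 := by
  unfold AllocationRule.interim
  rw [← integral_finsetSum]
  · have : ∀ t : Profile T, ∑ S : Finset (Fin m), ∑ a : Fin n → Finset (Fin m) with a i = S,
        X.prob (Function.update t i ti) a = 1 := fun t => by
      rw [Finset.sum_fiberwise, X.sum_eq_one]
    simp [this]
  · intro S _
    exact integrable_of_measurable_of_bounds
      ((X.measurable_sum_prob _).comp (measurable_update_left))
      (fun t => Finset.sum_nonneg fun a _ => X.nonneg _ a) (fun t => X.sum_prob_le_one _ _)

theorem AllocationRule.itemInterim_nonneg (i : Fin n) (j : Fin m) (ti : BidderType T i) :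
    0 ≤ X.itemInterim D i j ti :=
  Finset.sum_nonneg fun S _ => X.interim_nonneg D i S ti

theorem AllocationRule.itemInterim_le_one (i : Fin n) (j : Fin m) (ti : BidderType T i) :
    X.itemInterim D i j ti ≤ 1 := by
  rw [← X.sum_interim D i ti]
  exact Finset.sum_le_sum_of_subset_of_nonneg (Finset.subset_univ _) fun S _ _ =>
    X.interim_nonneg D i S ti

theorem AllocationRule.integrable_itemInterim (i : Fin n) (j : Fin m) :
    Integrable (X.itemInterim D i j) (bidderDist D i) :=
  integrable_of_measurable_of_bounds (Finset.measurable_sum _ fun S _ => X.measurable_interim D i S)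
    (X.itemInterim_nonneg D i j) (X.itemInterim_le_one D i j)

theorem AllocationRule.integral_interim (i : Fin n) (S : Finset (Fin m)) :
    ∫ ti, X.interim D i S ti ∂(bidderDist D i) =
      ∫ t, ∑ a : Fin n → Finset (Fin m) with a i = S, X.prob t a ∂(profileDist D) :=
  integral_integral_update (fun i => Measure.pi (D i)) i (X.measurable_sum_prob _)
    (fun _ => Finset.sum_nonneg fun a _ => X.nonneg _ a) (fun _ => X.sum_prob_le_one _ _)

/-- An item is allocated at most once in expectation. -/
theorem AllocationRule.sum_integral_itemInterim_le_one (j : Fin m) :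
    ∑ i, ∫ ti, X.itemInterim D i j ti ∂(bidderDist D i) ≤ 1 := by
  have hsum : ∀ i (S : Finset (Fin m)), Integrable (fun t =>
      ∑ a : Fin n → Finset (Fin m) with a i = S, X.prob t a) (profileDist D) := fun i S =>
    integrable_of_measurable_of_bounds (X.measurable_sum_prob _)
      (fun t => Finset.sum_nonneg fun a _ => X.nonneg _ a) (fun t => X.sum_prob_le_one _ _)
  have h1 : ∀ i, ∫ ti, X.itemInterim D i j ti ∂(bidderDist D i) =
      ∫ t, ∑ S : Finset (Fin m) with j ∈ S, ∑ a : Fin n → Finset (Fin m) with a i = S,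
        X.prob t a ∂(profileDist D) := by
    intro i
    unfold AllocationRule.itemInterim
    rw [integral_finsetSum, integral_finsetSum _ fun S _ => hsum i S]
    · exact Finset.sum_congr rfl fun S _ => X.integral_interim D i S
    · intro S _
      refine integrable_of_measurable_of_bounds (X.measurable_interim D i S)
        (X.interim_nonneg D i S) (C := 1) fun ti => ?_
      rw [← X.sum_interim D i ti]
      exact Finset.single_le_sum (f := fun S => X.interim D i S ti)
        (fun S _ => X.interim_nonneg D i S ti) (Finset.mem_univ S)
  simp only [h1]
  rw [← integral_finsetSum _ fun i _ => integrable_finsetSum _ fun S _ => hsum i S]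
  have hpt : ∀ t, ∑ i, ∑ S : Finset (Fin m) with j ∈ S,
      ∑ a : Fin n → Finset (Fin m) with a i = S, X.prob t a ≤ 1 := by
    intro t
    have e : ∀ i, ∑ S : Finset (Fin m) with j ∈ S, ∑ a : Fin n → Finset (Fin m) with a i = S,
        X.prob t a = ∑ a, if j ∈ a i then X.prob t a else 0 := by
      intro i
      simp only [Finset.sum_filter]
      rw [← Finset.sum_filter, Finset.sum_comm]
      refine Finset.sum_congr rfl fun a _ => ?_
      rw [Finset.sum_ite_eq]
      simp
    simp only [e]
    rw [Finset.sum_comm, ← X.sum_eq_one t]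
    refine Finset.sum_le_sum fun a _ => ?_
    by_cases ha : X.prob t a = 0
    · simp [ha]
    · by_cases hex : ∃ i, j ∈ a i
      · obtain ⟨i, hi⟩ := hex
        rw [Finset.sum_eq_single i]
        · simp [hi]
        · intro k _ hk
          rw [if_neg]
          exact fun hjk => Finset.disjoint_left.1 (X.feasible t a ha k i hk) hjk hi
        · simp
      · push Not at hex
        simpa [hex] using X.nonneg t a
  simpa using integral_mono (integrable_finsetSum _ fun i _ => integrable_finsetSum _ fun S _ =>
    hsum i S) (integrable_const (1 : ℝ)) hpt

/-- `E_{t_i} [∑_{S ∋ j} σ_{iS}(t_i) f(t_i, S)]`. -/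
noncomputable def AllocationRule.interimExpectation (i : Fin n) (j : Fin m)
    (f : BidderType T i → Finset (Fin m) → ℝ) : ℝ :=
  ∫ ti, ∑ S : Finset (Fin m) with j ∈ S, X.interim D i S ti * f ti S ∂(bidderDist D i)

variable {i : Fin n} {j : Fin m} {f : BidderType T i → Finset (Fin m) → ℝ}

theorem AllocationRule.integrable_interim_sum (hf : ∀ S, Measurable fun ti => f ti S) {C : ℝ}
    (hC : ∀ ti S, j ∈ S → |f ti S| ≤ C) :
    Integrable (fun ti => ∑ S : Finset (Fin m) with j ∈ S, X.interim D i S ti * f ti S)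
      (bidderDist D i) := by
  refine Integrable.of_bound (Finset.measurable_sum _ fun S _ =>
    (X.measurable_interim D i S).mul (hf S)).aestronglyMeasurable |C| (.of_forall fun ti => ?_)
  calc ‖∑ S : Finset (Fin m) with j ∈ S, X.interim D i S ti * f ti S‖
      ≤ ∑ S : Finset (Fin m) with j ∈ S, X.interim D i S ti * |C| := by
        refine (norm_sum_le _ _).trans (Finset.sum_le_sum fun S hS => ?_)
        rw [norm_mul, Real.norm_of_nonneg (X.interim_nonneg D i S ti)]
        exact mul_le_mul_of_nonneg_left ((hC ti S (Finset.mem_filter.1 hS).2).trans (le_abs_self C))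
          (X.interim_nonneg D i S ti)
    _ = X.itemInterim D i j ti * |C| := by rw [← Finset.sum_mul]; rfl
    _ ≤ |C| := mul_le_of_le_one_left (abs_nonneg C) (X.itemInterim_le_one D i j ti)

theorem AllocationRule.interimExpectation_nonneg (hf : ∀ ti S, j ∈ S → 0 ≤ f ti S) :
    0 ≤ X.interimExpectation D i j f :=
  integral_nonneg fun ti => Finset.sum_nonneg fun S hS =>
    mul_nonneg (X.interim_nonneg D i S ti) (hf ti S (Finset.mem_filter.1 hS).2)

/-- A pointwise bound on `f` that does not depend on the bundle. -/
theorem AllocationRule.interimExpectation_le_integral (hf : ∀ S, Measurable fun ti => f ti S)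
    {C : ℝ} (hC : ∀ ti S, j ∈ S → |f ti S| ≤ C) {h : BidderType T i → ℝ}
    (hfh : ∀ ti S, j ∈ S → f ti S ≤ h ti)
    (hh : Integrable (fun ti => X.itemInterim D i j ti * h ti) (bidderDist D i)) :
    X.interimExpectation D i j f ≤ ∫ ti, X.itemInterim D i j ti * h ti ∂(bidderDist D i) := by
  refine integral_mono (X.integrable_interim_sum D hf hC) hh fun ti => ?_
  simp only [AllocationRule.itemInterim]
  rw [Finset.sum_mul]
  exact Finset.sum_le_sum fun S hS => mul_le_mul_of_nonneg_left
    (hfh ti S (Finset.mem_filter.1 hS).2) (X.interim_nonneg D i S ti)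

end Interim

/-! ### Item prices and their truncated part -/

section ItemPrices

variable {n m : ℕ} {T : Fin n → Fin m → Type*} [∀ i j, MeasurableSpace (T i j)]
  (D : ∀ i j, Measure (T i j)) [∀ i j, IsProbabilityMeasure (D i j)] {v : Valuation T}
  (X : AllocationRule T) {b : ℝ} {β : Fin n → Fin m → ℝ} {c : Fin n → ℝ} {α : ℝ}
  {γ : ∀ i : Fin n, BidderType T i → Finset (Fin m) → Fin m → ℝ}

theorem supportingPrice_le_truncate {w : Finset (Fin m) → ℝ} {S : Finset (Fin m)}
    {p : Fin m → ℝ} (h : IsSupportingPrices α w S p) {j : Fin m} (hj : j ∈ S) : p j ≤ w {j} := by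
  simpa using h.le_value {j} (by simpa using hj)

theorem supportingPrice_le_value (hv : SubadditiveOverItems v) {x : Fin m → ℝ} {i : Fin n}
    {ti : BidderType T i} {S : Finset (Fin m)} {p : Fin m → ℝ}
    (h : IsSupportingPrices α (truncate v i x ti) S p) {j : Fin m} (hj : j ∈ S) :
    p j ≤ v i ti {j} :=
  (supportingPrice_le_truncate h hj).trans (truncate_le hv i x ti _)

theorem supportingPrice_le_cutoff (hv : SubadditiveOverItems v) {x : Fin m → ℝ} {i : Fin n}
    {ti : BidderType T i} {S : Finset (Fin m)} {p : Fin m → ℝ}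
    (h : IsSupportingPrices α (truncate v i x ti) S p) {j : Fin m} (hj : j ∈ S) (hx : 0 ≤ x j) :
    p j ≤ x j := by
  rcases lt_or_ge (v i ti {j}) (x j) with hlt | hge
  · exact (supportingPrice_le_value hv h hj).trans hlt.le
  · exact (supportingPrice_le_truncate h hj).trans
      ((truncate_singleton_of_le hv i hge).le.trans hx)

/-- The part of the supporting price of `j` that is lost when the items of value at least `x` are
discarded. -/
noncomputable def discardedPrice (v : Valuation T)
    (γ : ∀ i : Fin n, BidderType T i → Finset (Fin m) → Fin m → ℝ) (x : ℝ) (i : Fin n) (j : Fin m)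
    (ti : BidderType T i) (S : Finset (Fin m)) : ℝ :=
  Set.indicator {t | x ≤ v i t {j}} (fun t => γ i t S j) ti

/-- The discarded part of the supporting prices is paid for by the posted price `max β x`. If
`x ≤ β`, values below `β` contribute at most `β` times the probability `π_{ij}` of receiving `j`,
and larger values at most `c` more; if `β < x`, all contributions are at most `β + c` and occur
with probability `Pr[V ≥ x]`. -/
theorem interimExpectation_discardedPrice_le (hv : SubadditiveOverItems v)
    (hb0 : 0 < b) (hb1 : b < 1) (hβ : ∀ i j, 0 ≤ β i j)
    (hβ₂ : ∀ i j, ∫ ti, X.itemInterim D i j ti ∂(bidderDist D i) ≤ tailProb D v i j (β i j) / b)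
    (hc : ∀ i, 0 ≤ c i) (hγm : ∀ i S j, Measurable (fun ti => γ i ti S j))
    (hγ : ∀ i ti S, IsSupportingPrices α (truncate v i (fun j => β i j + c i) ti) S (γ i ti S))
    (x : ℝ) (i : Fin n) (j : Fin m) :
    X.interimExpectation D i j (discardedPrice v γ x i j) ≤
      β i j * tailProb D v i j (max (β i j) x) / b + c i * tailProb D v i j (max (β i j) x) := by
  have hβc : 0 ≤ β i j + c i := add_nonneg (hβ i j) (hc i)
  have hm : ∀ y, MeasurableSet {t | y ≤ v i t {j}} := fun y => hv.measurable i {j} measurableSet_Ici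
  have hdm : ∀ S, Measurable fun ti => discardedPrice v γ x i j ti S := fun S =>
    (hγm i S j).indicator (hm x)
  have hd0 : ∀ ti S, j ∈ S → 0 ≤ discardedPrice v γ x i j ti S := fun ti S hj =>
    Set.indicator_apply_nonneg fun _ => (hγ i ti S).nonneg j hj
  have hγc : ∀ ti S, j ∈ S → γ i ti S j ≤ β i j + c i := fun ti S hj =>
    supportingPrice_le_cutoff hv (hγ i ti S) hj hβc
  have hdC : ∀ ti S, j ∈ S → |discardedPrice v γ x i j ti S| ≤ β i j + c i := fun ti S hj => by
    rw [abs_of_nonneg (hd0 ti S hj)]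
    exact Set.indicator_apply_le' (fun _ => hγc ti S hj) fun _ => hβc
  have hI : ∀ y, Integrable (Set.indicator {t | y ≤ v i t {j}} (1 : BidderType T i → ℝ))
      (bidderDist D i) := fun y => (integrable_const (1 : ℝ)).indicator (hm y)
  have hIint : ∀ y, ∫ ti, Set.indicator {t | y ≤ v i t {j}} (1 : BidderType T i → ℝ) ti
      ∂(bidderDist D i) = tailProb D v i j y := fun y => integral_indicator_one (hm y)
  have hI0 : ∀ y ti, 0 ≤ Set.indicator {t | y ≤ v i t {j}} (1 : BidderType T i → ℝ) ti :=
    fun y ti => Set.indicator_nonneg (fun _ _ => zero_le_one) ti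
  have hπ := X.integrable_itemInterim D i j
  have hπI : ∀ y, Integrable (fun ti => X.itemInterim D i j ti *
      Set.indicator {t | y ≤ v i t {j}} (1 : BidderType T i → ℝ) ti) (bidderDist D i) := fun y =>
    (hI y).bdd_mul hπ.aestronglyMeasurable (c := 1) (.of_forall fun ti => by
      rw [Real.norm_of_nonneg (X.itemInterim_nonneg D i j ti)]
      exact X.itemInterim_le_one D i j ti)
  have hπI_le : ∀ y, ∫ ti, X.itemInterim D i j ti *
      Set.indicator {t | y ≤ v i t {j}} (1 : BidderType T i → ℝ) ti ∂(bidderDist D i) ≤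
      tailProb D v i j y := fun y => by
    rw [← hIint y]
    exact integral_mono (hπI y) (hI y) fun ti =>
      mul_le_of_le_one_left (hI0 y ti) (X.itemInterim_le_one D i j ti)
  rcases le_or_gt x (β i j) with hx | hx
  · rw [max_eq_left hx]
    have hint : Integrable (fun ti => X.itemInterim D i j ti *
        (β i j + c i * Set.indicator {t | β i j ≤ v i t {j}} (1 : BidderType T i → ℝ) ti))
        (bidderDist D i) := by
      have := (hπ.const_mul (β i j)).add ((hπI (β i j)).const_mul (c i))
      refine this.congr (.of_forall fun ti => ?_)
      simp only [Pi.add_apply]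
      ring
    refine (X.interimExpectation_le_integral D hdm hdC (fun ti S hj => ?_) hint).trans ?_
    · by_cases hti : β i j ≤ v i ti {j}
      · rw [Set.indicator_of_mem (by exact hti), Pi.one_apply, mul_one]
        exact (le_abs_self _).trans (hdC ti S hj)
      · rw [Set.indicator_of_notMem (by exact hti), mul_zero, add_zero]
        exact Set.indicator_apply_le' (fun _ =>
          (supportingPrice_le_value hv (hγ i ti S) hj).trans (not_le.1 hti).le) fun _ => hβ i j
    · have e : ∫ ti, X.itemInterim D i j ti *
          (β i j + c i * Set.indicator {t | β i j ≤ v i t {j}} (1 : BidderType T i → ℝ) ti)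
          ∂(bidderDist D i) = β i j * ∫ ti, X.itemInterim D i j ti ∂(bidderDist D i) +
          c i * ∫ ti, X.itemInterim D i j ti *
            Set.indicator {t | β i j ≤ v i t {j}} (1 : BidderType T i → ℝ) ti
            ∂(bidderDist D i) := by
        rw [← integral_const_mul, ← integral_const_mul,
          ← integral_add (hπ.const_mul _) ((hπI _).const_mul _)]
        exact integral_congr_ae (.of_forall fun ti => by simp only; ring)
      rw [e, mul_div_assoc]
      exact add_le_add (mul_le_mul_of_nonneg_left (hβ₂ i j) (hβ i j))
        (mul_le_mul_of_nonneg_left (hπI_le _) (hc i))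
  · rw [max_eq_right hx.le]
    have hint : Integrable (fun ti => X.itemInterim D i j ti *
        ((β i j + c i) * Set.indicator {t | x ≤ v i t {j}} (1 : BidderType T i → ℝ) ti))
        (bidderDist D i) := by
      refine ((hπI x).const_mul (β i j + c i)).congr (.of_forall fun ti => ?_)
      simp only
      ring
    refine (X.interimExpectation_le_integral D hdm hdC (fun ti S hj => ?_) hint).trans ?_
    · by_cases hti : x ≤ v i ti {j}
      · rw [Set.indicator_of_mem (by exact hti), Pi.one_apply, mul_one]
        exact (le_abs_self _).trans (hdC ti S hj)
      · rw [discardedPrice, Set.indicator_of_notMem (by exact hti),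
          Set.indicator_of_notMem (by exact hti), mul_zero]
    · have e : ∫ ti, X.itemInterim D i j ti *
          ((β i j + c i) * Set.indicator {t | x ≤ v i t {j}} (1 : BidderType T i → ℝ) ti)
          ∂(bidderDist D i) = (β i j + c i) * ∫ ti, X.itemInterim D i j ti *
            Set.indicator {t | x ≤ v i t {j}} (1 : BidderType T i → ℝ) ti
            ∂(bidderDist D i) := by
        rw [← integral_const_mul]
        exact integral_congr_ae (.of_forall fun ti => by simp only; ring)
      have h1 : β i j * tailProb D v i j x ≤ β i j * tailProb D v i j x / b := by
        rw [le_div_iff₀ hb0]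
        exact mul_le_of_le_one_right (mul_nonneg (hβ i j) (tailProb_nonneg D v i j x)) hb1.le
      rw [e]
      have h2 := mul_le_mul_of_nonneg_left (hπI_le x) hβc
      linarith

end ItemPrices

/-! ### The net gain from the allocation rule and the median fees -/

section Gain

variable {n m : ℕ} {T : Fin n → Fin m → Type*} [∀ i j, MeasurableSpace (T i j)]
  (D : ∀ i j, Measure (T i j)) [∀ i j, IsProbabilityMeasure (D i j)] {v : Valuation T}
  {tb : TieBreaking n m}
  (X : AllocationRule T) {b : ℝ} {β : Fin n → Fin m → ℝ} {c : Fin n → ℝ} {α : ℝ}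
  {γ : ∀ i : Fin n, BidderType T i → Finset (Fin m) → Fin m → ℝ}

theorem sum_interimExpectation_discardedPrice_le (hv : SubadditiveOverItems v)
    (hR : PostRev D tb v ≠ ∞)
    (hb0 : 0 < b) (hb1 : b < 1) (hβ : ∀ i j, 0 ≤ β i j)
    (hβ₁ : ∀ i j, ∑ k ∈ Finset.univ.erase i, tailProb D v k j (β k j) ≤ b)
    (hβ₂ : ∀ i j, ∫ ti, X.itemInterim D i j ti ∂(bidderDist D i) ≤ tailProb D v i j (β i j) / b)
    (hc : ∀ i, c i = coreCutoff D v β i) (hγm : ∀ i S j, Measurable (fun ti => γ i ti S j))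
    (hγ : ∀ i ti S, IsSupportingPrices α (truncate v i (fun j => β i j + c i) ti) S (γ i ti S))
    {x : Fin n → Fin m → ℝ} (hs : ∀ i, ∑ j, tailProb D v i j (max (β i j) (x i j)) ≤ 1 / 2) :
    ∑ i, ∑ j, X.interimExpectation D i j (discardedPrice v γ (x i j) i j) ≤
      (2 / (b * (1 - b)) + 2 / (1 - b)) * (PostRev D tb v).toReal := by
  set R := (PostRev D tb v).toReal
  have hc0 : ∀ i, 0 ≤ c i := fun i => by rw [hc i]; exact coreCutoff_nonneg D v β i
  have h1b : 0 < 1 - b := sub_pos.2 hb1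
  set t : Fin n → Fin m → ℝ := fun i j => tailProb D v i j (max (β i j) (x i j)) with ht
  have ht0 : ∀ i j, 0 ≤ t i j := fun i j => tailProb_nonneg D v i j _
  have hA : (1 - b) / 2 * ∑ i, ∑ j, max (β i j) (x i j) * t i j ≤ R :=
    sum_price_mul_tailProb_le D hv hR (P := fun i j => max (β i j) (x i j))
      (fun i j => (hβ i j).trans (le_max_left _ _)) hb1
      (sum_erase_tailProb_le_of_le D (fun i j => le_max_left _ _) hβ₁) hs
  have hC : (1 - b) / 4 * ∑ i, c i ≤ R := by
    simp only [hc]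
    exact sum_coreCutoff_le D hv hR hb1 hβ hβ₁
  have h1 : ∀ i, ∑ j, X.interimExpectation D i j (discardedPrice v γ (x i j) i j) ≤
      (∑ j, max (β i j) (x i j) * t i j) / b + c i / 2 := by
    intro i
    calc ∑ j, X.interimExpectation D i j (discardedPrice v γ (x i j) i j)
        ≤ ∑ j, (max (β i j) (x i j) * t i j / b + c i * t i j) := by
          refine Finset.sum_le_sum fun j _ => (interimExpectation_discardedPrice_le D X hv hb0 hb1
            hβ hβ₂ hc0 hγm hγ (x i j) i j).trans (add_le_add_left ?_ _)
          exact div_le_div_of_nonneg_right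
            (mul_le_mul_of_nonneg_right (le_max_left _ _) (ht0 i j)) hb0.le
      _ = (∑ j, max (β i j) (x i j) * t i j) / b + c i * ∑ j, t i j := by
          rw [Finset.sum_add_distrib, Finset.sum_div, Finset.mul_sum]
      _ ≤ _ := by
          have := mul_le_mul_of_nonneg_left (hs i) (hc0 i)
          linarith
  have h2 : ∑ i, ∑ j, max (β i j) (x i j) * t i j ≤ 2 / (1 - b) * R := by
    rw [div_mul_eq_mul_div, le_div_iff₀ h1b]
    linarith
  have h3 : ∑ i, c i ≤ 4 / (1 - b) * R := by
    rw [div_mul_eq_mul_div, le_div_iff₀ h1b]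
    linarith
  calc ∑ i, ∑ j, X.interimExpectation D i j (discardedPrice v γ (x i j) i j)
      ≤ ∑ i, ((∑ j, max (β i j) (x i j) * t i j) / b + c i / 2) :=
        Finset.sum_le_sum fun i _ => h1 i
    _ = (∑ i, ∑ j, max (β i j) (x i j) * t i j) / b + (∑ i, c i) / 2 := by
        rw [Finset.sum_add_distrib, Finset.sum_div, Finset.sum_div]
    _ ≤ 2 / (1 - b) * R / b + 4 / (1 - b) * R / 2 := by gcongr
    _ = _ := by field_simp; ring

/-- The positive part of the net supporting price of item `j`, after discarding the items of value
at least `q + τ`. -/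
noncomputable def netGain (v : Valuation T)
    (γ : ∀ i : Fin n, BidderType T i → Finset (Fin m) → Fin m → ℝ) (q τ : ℝ) (i : Fin n) (j : Fin m)
    (ti : BidderType T i) (S : Finset (Fin m)) : ℝ :=
  max (γ i ti S j - discardedPrice v γ (q + τ) i j ti S - q) 0

/-- A bidder who could buy any part of `S ∩ A` at the item prices `Q` would buy the items whose
supporting price exceeds their price. -/
theorem sum_netGain_le_maxSurplus (hv : SubadditiveOverItems v) {x : Fin m → ℝ}
    {i : Fin n} {ti : BidderType T i} {S : Finset (Fin m)}
    (hγ : IsSupportingPrices α (truncate v i x ti) S (γ i ti S)) {Q : Fin m → ℝ}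
    (hQ : ∀ j, 0 ≤ Q j) (τ : ℝ) (A : Finset (Fin m)) :
    ∑ j ∈ A with j ∈ S, netGain v γ (Q j) τ i j ti S ≤
      maxSurplus (truncate v i (fun j => Q j + τ) ti) Q A := by
  classical
  set K := A.filter fun j => j ∈ S ∧ v i ti {j} < Q j + τ ∧ Q j < γ i ti S j with hK
  have hKA : K ⊆ A := Finset.filter_subset _ _
  have hKS : K ⊆ S := fun j hj => (Finset.mem_filter.1 hj).2.1
  have e : ∑ j ∈ A with j ∈ S, netGain v γ (Q j) τ i j ti S = ∑ j ∈ K, (γ i ti S j - Q j) := by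
    have hKf : K ⊆ A.filter fun j => j ∈ S := fun j hj =>
      Finset.mem_filter.2 ⟨hKA hj, hKS hj⟩
    rw [← Finset.sum_subset hKf]
    · refine Finset.sum_congr rfl fun j hj => ?_
      obtain ⟨-, -, h1, h2⟩ := Finset.mem_filter.1 hj
      rw [netGain, discardedPrice, Set.indicator_of_notMem (by exact not_le.2 h1), sub_zero,
        max_eq_left (by linarith)]
    · intro j hj hjK
      obtain ⟨hjA, hjS⟩ := Finset.mem_filter.1 hj
      rw [netGain, discardedPrice]
      refine max_eq_right ?_
      by_cases h1 : Q j + τ ≤ v i ti {j}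
      · rw [Set.indicator_of_mem (by exact h1)]
        linarith [hQ j]
      · rw [Set.indicator_of_notMem (by exact h1)]
        by_contra! h2
        exact hjK (Finset.mem_filter.2 ⟨hjA, hjS, not_le.1 h1, by linarith⟩)
  rw [e]
  refine le_trans ?_ (surplus_le_maxSurplus _ Q hKA)
  rw [surplus, Finset.sum_sub_distrib,
    truncate_eq_of_forall_lt i fun j hj => (Finset.mem_filter.1 hj).2.2.1]
  exact sub_le_sub_right ((hγ.le_value K hKS).trans (truncate_le hv i _ ti K)) _

theorem abs_netGain_le (hv : SubadditiveOverItems v) {x : Fin m → ℝ} (hx : ∀ j, 0 ≤ x j)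
    {i : Fin n} {ti : BidderType T i} {S : Finset (Fin m)}
    (hγ : IsSupportingPrices α (truncate v i x ti) S (γ i ti S)) {q : ℝ} (hq : 0 ≤ q) (τ : ℝ)
    {j : Fin m} (hj : j ∈ S) : |netGain v γ q τ i j ti S| ≤ x j := by
  have h0 : 0 ≤ discardedPrice v γ (q + τ) i j ti S :=
    Set.indicator_apply_nonneg fun _ => hγ.nonneg j hj
  rw [netGain, abs_of_nonneg (le_max_right _ _)]
  exact max_le (by linarith [supportingPrice_le_cutoff hv hγ hj (hx j)]) (hx j)

theorem measurable_discardedPrice (hv : SubadditiveOverItems v)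
    (hγm : ∀ i S j, Measurable (fun ti => γ i ti S j)) (x : ℝ) (i : Fin n) (j : Fin m)
    (S : Finset (Fin m)) : Measurable fun ti => discardedPrice v γ x i j ti S :=
  (hγm i S j).indicator (hv.measurable i {j} measurableSet_Ici)

theorem measurable_netGain (hv : SubadditiveOverItems v)
    (hγm : ∀ i S j, Measurable (fun ti => γ i ti S j)) (q τ : ℝ) (i : Fin n) (j : Fin m)
    (S : Finset (Fin m)) : Measurable fun ti => netGain v γ q τ i j ti S :=
  (((hγm i S j).sub (measurable_discardedPrice hv hγm (q + τ) i j S)).sub_const q).max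
    measurable_const

theorem maxSurplus_truncate_le (hv : SubadditiveOverItems v) {Q : Fin m → ℝ} (hQ : ∀ j, 0 ≤ Q j)
    {τ : ℝ} (hτ : 0 ≤ τ) (i : Fin n) (ti : BidderType T i) (j : Fin m) :
    maxSurplus (truncate v i (fun j => Q j + τ) ti) Q {j} ≤ τ := by
  refine maxSurplus_le fun S hS => ?_
  rcases Finset.subset_singleton_iff.1 hS with rfl | rfl
  · rwa [surplus_empty (truncate_empty hv i _ ti)]
  · rw [surplus, Finset.sum_singleton]
    rcases lt_or_ge (v i ti {j}) (Q j + τ) with h | h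
    · rw [truncate_singleton_of_lt i h]; linarith
    · rw [truncate_singleton_of_le hv i h]; linarith [hQ j]

/-- The truncated surplus is subadditive over independent items and `τ`-Lipschitz, so its mean is
controlled by its median. -/
theorem integral_maxSurplus_truncate_le (hv : SubadditiveOverItems v) {Q : Fin m → ℝ}
    (hQ : ∀ j, 0 ≤ Q j) {τ : Fin n → ℝ} (hτ : ∀ i, 0 ≤ τ i) (i : Fin n) (A : Finset (Fin m)) :
    ∫ ti, maxSurplus (truncate v i (fun j => Q j + τ i) ti) Q A ∂(bidderDist D i) ≤
      2 * medianFee D v Q τ i A + 2 * τ i := by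
  have hm : Measurable fun ti => maxSurplus (truncate v i (fun j => Q j + τ i) ti) Q A :=
    measurable_maxSurplus (fun S => measurable_truncate hv i _ S) Q A
  exact integral_le_two_mul_median_add (D i)
    (h := fun ti U => maxSurplus (truncate v i (fun j => Q j + τ i) ti) Q U) hm
    (fun ti => maxSurplus_empty (truncate_empty hv i _ ti) Q)
    (fun ti U W h => maxSurplus_mono _ Q h)
    (fun ti U W => maxSurplus_union_le (truncate_union_le hv i _ ti) Q U W)
    (fun ti ti' U h => maxSurplus_congr Q fun S hS =>
      truncate_congr hv i _ fun j hj => h j (hS hj))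
    (hτ i) (fun ti j => maxSurplus_truncate_le hv hQ (hτ i) i ti j)
    (half_le_measureReal_le_median (bidderDist D i) hm)

theorem integrable_maxSurplus_truncate (hv : SubadditiveOverItems v) (Q : Fin m → ℝ)
    (hQ : ∀ j, 0 ≤ Q j) {τ : ℝ} (hτ : 0 ≤ τ) (i : Fin n) (A : Finset (Fin m)) :
    Integrable (fun ti => maxSurplus (truncate v i (fun j => Q j + τ) ti) Q A)
      (bidderDist D i) := by
  refine integrable_of_measurable_of_bounds
    (measurable_maxSurplus (fun S => measurable_truncate hv i _ S) Q A)
    (fun ti => maxSurplus_nonneg (truncate_empty hv i _ ti) Q A) (C := A.card * τ) fun ti => ?_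
  classical
  induction A using Finset.induction_on with
  | empty => simp [maxSurplus_empty (truncate_empty hv i _ ti)]
  | insert j U hj ih =>
    rw [Finset.card_insert_of_notMem hj, Finset.insert_eq]
    push_cast
    linarith [maxSurplus_union_le (truncate_union_le hv i (fun j => Q j + τ) ti) Q {j} U,
      maxSurplus_truncate_le hv hQ hτ i ti j]

/-- The expected truncated surplus from `A` is at least the expected net gain from the items of `A`
in the allocation rule `X`. -/
theorem sum_interimExpectation_netGain_le (hv : SubadditiveOverItems v)
    (hγm : ∀ i S j, Measurable (fun ti => γ i ti S j)) {i : Fin n} {x : Fin m → ℝ}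
    (hx : ∀ j, 0 ≤ x j)
    (hγ : ∀ ti S, IsSupportingPrices α (truncate v i x ti) S (γ i ti S))
    {Q : Fin m → ℝ} (hQ : ∀ j, 0 ≤ Q j) {τ : ℝ} (hτ : 0 ≤ τ) (A : Finset (Fin m)) :
    ∑ j ∈ A, X.interimExpectation D i j (netGain v γ (Q j) τ i j) ≤
      ∫ ti, maxSurplus (truncate v i (fun j => Q j + τ) ti) Q A ∂(bidderDist D i) := by
  have hint : ∀ j, Integrable (fun ti => ∑ S : Finset (Fin m) with j ∈ S,
      X.interim D i S ti * netGain v γ (Q j) τ i j ti S) (bidderDist D i) := fun j =>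
    X.integrable_interim_sum D (measurable_netGain hv hγm (Q j) τ i j) fun ti S hj =>
      abs_netGain_le hv hx (hγ ti S) (hQ j) τ hj
  unfold AllocationRule.interimExpectation
  rw [← integral_finsetSum _ fun j _ => hint j]
  refine integral_mono (integrable_finsetSum _ fun j _ => hint j)
    (integrable_maxSurplus_truncate D hv Q hQ hτ i A) fun ti => ?_
  calc ∑ j ∈ A, ∑ S : Finset (Fin m) with j ∈ S,
        X.interim D i S ti * netGain v γ (Q j) τ i j ti S
      = ∑ S, X.interim D i S ti * ∑ j ∈ A with j ∈ S, netGain v γ (Q j) τ i j ti S := by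
        simp only [Finset.sum_filter, Finset.mul_sum]
        rw [Finset.sum_comm]
        refine Finset.sum_congr rfl fun S _ => Finset.sum_congr rfl fun j _ => ?_
        split_ifs <;> simp
    _ ≤ ∑ S, X.interim D i S ti * maxSurplus (truncate v i (fun j => Q j + τ) ti) Q A :=
        Finset.sum_le_sum fun S _ => mul_le_mul_of_nonneg_left
          (sum_netGain_le_maxSurplus hv (hγ ti S) hQ τ A) (X.interim_nonneg D i S ti)
    _ = _ := by rw [← Finset.sum_mul, X.sum_interim D, one_mul]

/-- The supporting prices of item `j` are worth `2 Q j` in total, and `j` is allocated at most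
once. -/
theorem itemPrice_sub_le_sum_netGain (hv : SubadditiveOverItems v)
    (hγm : ∀ i S j, Measurable (fun ti => γ i ti S j)) {x : Fin n → Fin m → ℝ}
    (hx : ∀ i j, 0 ≤ x i j)
    (hγ : ∀ i ti S, IsSupportingPrices α (truncate v i (x i) ti) S (γ i ti S))
    {Q : Fin m → ℝ} (hQ : ∀ j, 0 ≤ Q j) (hQX : ∀ j, Q j = itemPrice D X γ j) (τ : Fin n → ℝ)
    (j : Fin m) :
    Q j - ∑ i, X.interimExpectation D i j (discardedPrice v γ (Q j + τ i) i j) ≤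
      ∑ i, X.interimExpectation D i j (netGain v γ (Q j) (τ i) i j) := by
  have h1 : ∀ i, X.interimExpectation D i j (fun ti S => γ i ti S j) -
      X.interimExpectation D i j (discardedPrice v γ (Q j + τ i) i j) -
      (∫ ti, X.itemInterim D i j ti ∂(bidderDist D i)) * Q j ≤
      X.interimExpectation D i j (netGain v γ (Q j) (τ i) i j) := by
    intro i
    have hγb : ∀ ti S, j ∈ S → |γ i ti S j| ≤ x i j := fun ti S hj => by
      rw [abs_of_nonneg ((hγ i ti S).nonneg j hj)]
      exact supportingPrice_le_cutoff hv (hγ i ti S) hj (hx i j)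
    have hi1 := X.integrable_interim_sum D (i := i) (j := j) (f := fun ti S => γ i ti S j)
      (fun S => hγm i S j) hγb
    have hi2 := X.integrable_interim_sum D (i := i) (j := j)
      (f := discardedPrice v γ (Q j + τ i) i j)
      (measurable_discardedPrice hv hγm (Q j + τ i) i j) (C := x i j) fun ti S hj => by
        rw [discardedPrice]
        by_cases h : ti ∈ {t | Q j + τ i ≤ v i t {j}}
        · rw [Set.indicator_of_mem h]; exact hγb ti S hj
        · rw [Set.indicator_of_notMem h, abs_zero]; exact hx i j
    have hi3 := (X.integrable_itemInterim D i j).mul_const (Q j)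
    have hi4 := X.integrable_interim_sum D (measurable_netGain hv hγm (Q j) (τ i) i j)
      fun ti S hj => abs_netGain_le hv (hx i) (hγ i ti S) (hQ j) (τ i) hj
    have hi12 : Integrable (fun ti =>
        (∑ S : Finset (Fin m) with j ∈ S, X.interim D i S ti * γ i ti S j) -
          ∑ S : Finset (Fin m) with j ∈ S,
            X.interim D i S ti * discardedPrice v γ (Q j + τ i) i j ti S) (bidderDist D i) :=
      hi1.sub hi2
    unfold AllocationRule.interimExpectation
    rw [← integral_mul_const, ← integral_sub hi1 hi2, ← integral_sub hi12 hi3]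
    refine integral_mono (hi12.sub hi3) hi4 fun ti => ?_
    simp only [AllocationRule.itemInterim]
    rw [Finset.sum_mul, ← Finset.sum_sub_distrib, ← Finset.sum_sub_distrib]
    refine Finset.sum_le_sum fun S _ => ?_
    rw [← mul_sub, ← mul_sub]
    exact mul_le_mul_of_nonneg_left (le_max_left _ _) (X.interim_nonneg D i S ti)
  have h2 := Finset.sum_le_sum fun i (_ : i ∈ Finset.univ) => h1 i
  rw [Finset.sum_sub_distrib, Finset.sum_sub_distrib, ← Finset.sum_mul] at h2
  have h3 : ∑ i, X.interimExpectation D i j (fun ti S => γ i ti S j) = 2 * Q j := by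
    rw [hQX j, itemPrice]
    simp only [AllocationRule.interimExpectation]
    ring
  have h4 := mul_le_mul_of_nonneg_right (X.sum_integral_itemInterim_le_one D j) (hQ j)
  linarith

theorem itemPrice_nonneg {x : Fin n → Fin m → ℝ}
    (hγ : ∀ i ti S, IsSupportingPrices α (truncate v i (x i) ti) S (γ i ti S)) (j : Fin m) :
    0 ≤ itemPrice D X γ j :=
  mul_nonneg (by norm_num) (Finset.sum_nonneg fun i _ =>
    X.interimExpectation_nonneg D fun ti S hj => (hγ i ti S).nonneg j hj)

end Gain

/-! ### The revenue of posted price mechanisms with entry fees -/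

section FiniteValued

variable {Ω ι : Type*} [Fintype ι]

theorem comp_eq_sum_indicator (F : Ω → ι) (φ : ι → ℝ) (ω : Ω) :
    φ (F ω) = ∑ a, φ a * Set.indicator {ω | F ω = a} 1 ω := by
  rw [Finset.sum_eq_single (F ω)]
  · simp [Set.indicator]
  · intro a _ ha
    simp [Set.indicator, ha.symm]
  · simp

variable [MeasurableSpace Ω] (P : Measure Ω) [IsProbabilityMeasure P] {F : Ω → ι}

theorem integrable_comp_of_measurableSet_fiber (hF : ∀ a, MeasurableSet {ω | F ω = a})
    (φ : ι → ℝ) : Integrable (fun ω => φ (F ω)) P := by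
  simp only [comp_eq_sum_indicator F φ]
  exact integrable_finsetSum _ fun a _ =>
    ((integrable_const (1 : ℝ)).indicator (hF a)).const_mul _

theorem integral_comp_of_measurableSet_fiber (hF : ∀ a, MeasurableSet {ω | F ω = a})
    (φ : ι → ℝ) : ∫ ω, φ (F ω) ∂P = ∑ a, φ a * P.real {ω | F ω = a} := by
  simp only [comp_eq_sum_indicator F φ]
  have hint : ∀ a, Integrable (fun ω => φ a * Set.indicator {ω | F ω = a} (1 : Ω → ℝ) ω) P :=
    fun a => ((integrable_const (1 : ℝ)).indicator (hF a)).const_mul _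
  rw [integral_finsetSum _ fun a _ => hint a]
  exact Finset.sum_congr rfl fun a _ => by rw [integral_const_mul, integral_indicator_one (hF a)]

end FiniteValued

section EntryFees

variable {n m : ℕ} {T : Fin n → Fin m → Type*} [∀ i j, MeasurableSpace (T i j)]
  {v : Valuation T}

theorem measurableSet_aspeAccepts (hv : SubadditiveOverItems v) (p : Fin m → ℝ)
    (δ : Fin n → Finset (Fin m) → ℝ) (i : Fin n) (A : Finset (Fin m)) :
    MeasurableSet {t : BidderType T i | aspeAccepts v p δ i t A} :=
  (measurable_maxSurplus (fun S => hv.measurable i S) p A) measurableSet_Ici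

theorem measurableSet_aspeBuy_eq (tb : TieBreaking n m) (hv : SubadditiveOverItems v)
    (p : Fin m → ℝ) (δ : Fin n → Finset (Fin m) → ℝ) (i : Fin n) (A B : Finset (Fin m)) :
    MeasurableSet {t : BidderType T i | aspeBuy tb v p δ i t A = B} := by
  have hacc := measurableSet_aspeAccepts hv p δ i A
  have hpick := measurableSet_pick_favourites_eq (fun S => hv.measurable i S) p A.powerset
    (tb.pick i) B
  have : {t : BidderType T i | aspeBuy tb v p δ i t A = B} =
      ({t | aspeAccepts v p δ i t A} ∩ {t | tb.pick i (favourites (v i t) p A.powerset) = B}) ∪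
      ({t | aspeAccepts v p δ i t A}ᶜ ∩ {_t | ∅ = B}) := by
    ext t
    by_cases h : aspeAccepts v p δ i t A <;> simp [aspeBuy, h]
  rw [this]
  exact (hacc.inter hpick).union (hacc.compl.inter (MeasurableSet.const _))

variable (D : ∀ i j, Measure (T i j)) [∀ i j, IsProbabilityMeasure (D i j)]

/-- A bidder accepts her median fee with probability at least `1 / 2`, because truncation only
decreases the surplus. -/
theorem half_le_measureReal_aspeAccepts (hv : SubadditiveOverItems v) (Q : Fin m → ℝ)
    (τ : Fin n → ℝ) {δ : Fin n → Finset (Fin m) → ℝ} (hδ : ∀ i S, δ i S = medianFee D v Q τ i S)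
    (i : Fin n) (A : Finset (Fin m)) :
    1 / 2 ≤ (bidderDist D i).real {ti | aspeAccepts v Q δ i ti A} := by
  refine (half_le_measureReal_median_le (bidderDist D i)
    (measurable_maxSurplus (fun S => measurable_truncate hv i (fun j => Q j + τ i) S) Q A)
    fun ti => maxSurplus_nonneg (truncate_empty hv i _ ti) Q A).trans
    (measureReal_mono fun ti hti => ?_)
  change δ i A ≤ _
  rw [hδ]
  exact le_trans hti (maxSurplus_mono_left (truncate_le hv i _ ti) Q A)

variable (tb : TieBreaking n m)

/-- Every unsold item `j` contributes `∑ i, e i j` to the values on which the entry fees are based,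
and every sold item contributes its price. Each fee is accepted with probability at least `1 / 2`,
independently of the set that is offered to the bidder. -/
theorem le_aspeRevenue (hv : SubadditiveOverItems v) {Q : Fin m → ℝ} (hQ : ∀ j, 0 ≤ Q j)
    {δ : Fin n → Finset (Fin m) → ℝ} (hδ : ∀ i A, 0 ≤ δ i A)
    (hacc : ∀ i A, 1 / 2 ≤ (bidderDist D i).real {ti | aspeAccepts v Q δ i ti A})
    {e : Fin n → Fin m → ℝ} (he : ∀ i j, 0 ≤ e i j) {τ : Fin n → ℝ}
    (hfee : ∀ i A, ∑ j ∈ A, e i j ≤ 2 * δ i A + 2 * τ i)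
    {K : Fin m → ℝ} (hKQ : ∀ j, K j ≤ Q j) (hKe : ∀ j, K j ≤ ∑ i, e i j) :
    ENNReal.ofReal (1 / 4 * ∑ j, K j - 1 / 2 * ∑ i, τ i) ≤ aspeRevenue D tb v Q δ := by
  classical
  set rem : Profile T → ℕ → Finset (Fin m) := remaining (aspeBuy tb v Q δ) with hrem
  have hbuy := measurableSet_aspeBuy_eq tb hv Q δ
  have hrm : ∀ k A, MeasurableSet {t | rem t k = A} := measurableSet_remaining_eq _ hbuy
  have hEm : ∀ (i : Fin n) A, MeasurableSet {t | t ∈ {t | rem t i = A} ∧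
      t i ∈ {ti | aspeAccepts v Q δ i ti A}} := fun i A =>
    (hrm i A).inter (measurable_pi_apply i (measurableSet_aspeAccepts hv Q δ i A))
  set fee : Fin n → Profile T → ℝ := fun i t => ∑ A, δ i A * Set.indicator
    {t | t ∈ {t | rem t i = A} ∧ t i ∈ {ti | aspeAccepts v Q δ i ti A}} 1 t with hfeedef
  have hfee_int : ∀ (i : Fin n) A, Integrable (fun t => δ i A * Set.indicator
      {t | t ∈ {t | rem t i = A} ∧ t i ∈ {ti | aspeAccepts v Q δ i ti A}}
      (1 : Profile T → ℝ) t) (profileDist D) := fun i A =>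
    ((integrable_const (1 : ℝ)).indicator (hEm i A)).const_mul _
  have hfee_eq : ∀ i t, fee i t =
      if aspeAccepts v Q δ i (t i) (rem t i) then δ i (rem t i) else 0 := by
    intro i t
    simp only [hfeedef]
    rw [Finset.sum_eq_single (rem t i)]
    · by_cases h : aspeAccepts v Q δ i (t i) (rem t i) <;> simp [Set.indicator, h]
    · intro A _ hA
      simp [Set.indicator, hA.symm]
    · simp
  have hfee0 : ∀ i t, 0 ≤ fee i t := fun i t => by
    rw [hfee_eq]; split_ifs
    exacts [hδ _ _, le_rfl]
  have hfee_half : ∀ i, ∫ t, δ i (rem t i) / 2 ∂(profileDist D) ≤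
      ∫ t, fee i t ∂(profileDist D) := by
    intro i
    rw [integral_comp_of_measurableSet_fiber (profileDist D) (hrm i) fun A => δ i A / 2,
      integral_finsetSum _ fun A _ => hfee_int i A]
    refine Finset.sum_le_sum fun A _ => ?_
    rw [integral_const_mul, integral_indicator_one (hEm i A)]
    have h : (profileDist D).real {t | t ∈ {t | rem t i = A} ∧
        t i ∈ {ti | aspeAccepts v Q δ i ti A}} = (profileDist D).real {t | rem t i = A} *
        (bidderDist D i).real {ti | aspeAccepts v Q δ i ti A} :=
      measureReal_inter_of_update_invariant (fun i => Measure.pi (D i)) i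
        (measurableSet_aspeAccepts hv Q δ i A) (hrm i A) fun t x => by
          simp only [Set.mem_ofPred_eq, hrem, remaining_update _ t i x le_rfl]
    rw [h]
    have h0 : 0 ≤ δ i A * (profileDist D).real {t | rem t i = A} :=
      mul_nonneg (hδ i A) measureReal_nonneg
    nlinarith [mul_le_mul_of_nonneg_left (hacc i A) h0]
  set sold : Finset (Fin m) → ℝ := fun A => ∑ j ∈ Aᶜ, Q j with hsold
  have hsold0 : ∀ A, 0 ≤ sold A := fun A => Finset.sum_nonneg fun j _ => hQ j
  have hsold_int : Integrable (fun t => sold (rem t n)) (profileDist D) :=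
    integrable_comp_of_measurableSet_fiber _ (hrm n) sold
  have hδint : ∀ i : Fin n, Integrable (fun t => δ i (rem t i) / 2) (profileDist D) := fun i =>
    integrable_comp_of_measurableSet_fiber _ (hrm i) fun A => δ i A / 2
  have hfee_int' : ∀ i, Integrable (fee i) (profileDist D) := fun i =>
    integrable_finsetSum _ fun A _ => hfee_int i A
  have hG : ∀ t, ∑ i, fee i t + sold (rem t n) ≤ ∑ i, aspePayment tb v Q δ t i := by
    intro t
    have hs : sold (rem t n) ≤
        ∑ i : Fin n, ∑ j ∈ aspeBuy tb v Q δ i (t i) (rem t i), Q j := by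
      have e0 : ∑ i : Fin n, ∑ j ∈ aspeBuy tb v Q δ i (t i) (rem t i), Q j =
          ∑ j, ∑ i : Fin n, if j ∈ aspeBuy tb v Q δ i (t i) (rem t i) then Q j else 0 := by
        rw [Finset.sum_comm]
        exact Finset.sum_congr rfl fun i _ => by simp
      have hite : ∀ (i : Fin n) j,
          0 ≤ if j ∈ aspeBuy tb v Q δ i (t i) (rem t i) then Q j else 0 := fun i j => by
        split_ifs
        exacts [hQ j, le_rfl]
      rw [e0]
      refine (Finset.sum_le_sum fun j hj => ?_).trans (Finset.sum_le_sum_of_subset_of_nonneg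
        (Finset.subset_univ (rem t n)ᶜ) fun j _ _ => Finset.sum_nonneg fun i _ => hite i j)
      obtain ⟨i, -, -, hij⟩ := exists_mem_buy_of_notMem_remaining _ t (Finset.mem_compl.1 hj)
      refine le_trans ?_ (Finset.single_le_sum (fun i _ => hite i j) (Finset.mem_univ i))
      rw [if_pos hij]
    have e1 : ∑ i, aspePayment tb v Q δ t i = ∑ i, fee i t +
        ∑ i : Fin n, ∑ j ∈ aspeBuy tb v Q δ i (t i) (rem t i), Q j := by
      rw [← Finset.sum_add_distrib]
      refine Finset.sum_congr rfl fun i _ => ?_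
      rw [hfee_eq]
      simp only [aspePayment, aspeAvailable, hrem]
      congr
    rw [e1]
    linarith
  have hconst : ∀ t, 1 / 4 * ∑ j, K j - 1 / 2 * ∑ i, τ i ≤
      ∑ i : Fin n, δ i (rem t i) / 2 + sold (rem t n) := by
    intro t
    have h1 : ∀ i : Fin n, 1 / 4 * ∑ j ∈ rem t n, e i j - 1 / 2 * τ i ≤ δ i (rem t i) / 2 := by
      intro i
      have hsub : rem t n ⊆ rem t i := remaining_antitone _ t i.2.le
      have := Finset.sum_le_sum_of_subset_of_nonneg hsub fun j _ _ => he i j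
      linarith [hfee i (rem t i)]
    have h2 := Finset.sum_le_sum fun i (_ : i ∈ Finset.univ) => h1 i
    rw [Finset.sum_sub_distrib, ← Finset.mul_sum, ← Finset.mul_sum, Finset.sum_comm] at h2
    have h3 : ∑ j ∈ rem t n, K j ≤ ∑ j ∈ rem t n, ∑ i, e i j :=
      Finset.sum_le_sum fun j _ => hKe j
    have h4 : 1 / 4 * ∑ j ∈ (rem t n)ᶜ, K j ≤ sold (rem t n) := by
      rw [Finset.mul_sum]
      exact Finset.sum_le_sum fun j _ => by linarith [hKQ j, hQ j]
    have h5 := Finset.sum_add_sum_compl (rem t n) K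
    linarith
  calc ENNReal.ofReal (1 / 4 * ∑ j, K j - 1 / 2 * ∑ i, τ i)
      ≤ ENNReal.ofReal (∫ t, (∑ i, fee i t + sold (rem t n)) ∂(profileDist D)) := by
        refine ENNReal.ofReal_le_ofReal ?_
        have hc := integral_mono (integrable_const (1 / 4 * ∑ j, K j - 1 / 2 * ∑ i, τ i))
          ((integrable_finsetSum Finset.univ fun i _ => hδint i).add hsold_int) hconst
        have e2 : ∫ t, (∑ i : Fin n, δ i (rem t i) / 2 + sold (rem t n)) ∂(profileDist D) =
            ∑ i : Fin n, ∫ t, δ i (rem t i) / 2 ∂(profileDist D) +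
              ∫ t, sold (rem t n) ∂(profileDist D) := by
          rw [integral_add (integrable_finsetSum _ fun i _ => hδint i) hsold_int,
            integral_finsetSum _ fun i _ => hδint i]
        rw [integral_add (integrable_finsetSum _ fun i _ => hfee_int' i) hsold_int,
          integral_finsetSum _ fun i _ => hfee_int' i]
        have h3 := Finset.sum_le_sum fun i (_ : i ∈ Finset.univ) => hfee_half i
        simp only [integral_const, probReal_univ, one_smul] at hc
        have hc' := hc.trans_eq e2
        linarith
    _ = ∫⁻ t, ENNReal.ofReal (∑ i, fee i t + sold (rem t n)) ∂(profileDist D) :=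
        ofReal_integral_eq_lintegral_ofReal
          ((integrable_finsetSum _ fun i _ => hfee_int' i).add hsold_int)
          (.of_forall fun t => add_nonneg (Finset.sum_nonneg fun i _ => hfee0 i t) (hsold0 _))
    _ ≤ aspeRevenue D tb v Q δ := lintegral_mono fun t => ENNReal.ofReal_le_ofReal (hG t)

variable (X : AllocationRule T) {b : ℝ} {β : Fin n → Fin m → ℝ} {c : Fin n → ℝ} {α : ℝ}
  {γ : ∀ i : Fin n, BidderType T i → Finset (Fin m) → Fin m → ℝ}

/-- The revenue with median fees for truncation levels `τ' i` at or above the cutoffs, provided that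
the tail probabilities at `τ'` sum up to at most `1 / 2`. -/
theorem le_aspeRevenue_medianFee (hv : SubadditiveOverItems v)
    (hb0 : 0 < b) (hb1 : b < 1) (hβ : ∀ i j, 0 ≤ β i j)
    (hβ₁ : ∀ i j, ∑ k ∈ Finset.univ.erase i, tailProb D v k j (β k j) ≤ b)
    (hβ₂ : ∀ i j, ∫ ti, X.itemInterim D i j ti ∂(bidderDist D i) ≤ tailProb D v i j (β i j) / b)
    (hc : ∀ i, c i = coreCutoff D v β i) (hγm : ∀ i S j, Measurable (fun ti => γ i ti S j))
    (hγ : ∀ i ti S, IsSupportingPrices α (truncate v i (fun j => β i j + c i) ti) S (γ i ti S))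
    {Q : Fin m → ℝ} (hQX : ∀ j, Q j = itemPrice D X γ j) {τ : Fin n → ℝ}
    (hτ : ∀ i, feeCutoff D v β Q i ≤ τ i)
    (hs : ∀ i, ∑ j, tailProb D v i j (max (β i j) (Q j + τ i)) ≤ 1 / 2) :
    ENNReal.ofReal (1 / 4 * ∑ j, Q j - 1 / 2 * ∑ i, (τ i - feeCutoff D v β Q i)) ≤
      aspeRevenue D tb v Q (medianFee D v Q τ) +
        ENNReal.ofReal (5 / (2 * (1 - b)) + (b + 1) / (2 * b * (1 - b))) * PostRev D tb v := by
  have h1b : 0 < 1 - b := sub_pos.2 hb1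
  by_cases hR : PostRev D tb v = ∞
  · rw [hR, ENNReal.mul_top, add_top]
    · exact le_top
    · exact (ENNReal.ofReal_pos.2 (by positivity)).ne'
  have hβc : ∀ i j, 0 ≤ β i j + c i := fun i j =>
    add_nonneg (hβ i j) (by rw [hc i]; exact coreCutoff_nonneg D v β i)
  have hQ : ∀ j, 0 ≤ Q j := fun j => by
    rw [hQX]; exact itemPrice_nonneg D X hγ j
  have hτ0 : ∀ i, 0 ≤ τ i := fun i => (feeCutoff_nonneg D v β Q i).trans (hτ i)
  set R := (PostRev D tb v).toReal with hRdef
  set d : Fin n → Fin m → ℝ := fun i j =>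
    X.interimExpectation D i j (discardedPrice v γ (Q j + τ i) i j) with hd
  have hd0 : ∀ i j, 0 ≤ d i j := fun i j => X.interimExpectation_nonneg D fun ti S hj =>
    Set.indicator_apply_nonneg fun _ => (hγ i ti S).nonneg j hj
  have hdR : ∑ i, ∑ j, d i j ≤ (2 / (b * (1 - b)) + 2 / (1 - b)) * R :=
    sum_interimExpectation_discardedPrice_le D X hv hR hb0 hb1 hβ hβ₁ hβ₂ hc hγm hγ
      (x := fun i j => Q j + τ i) hs
  have hτR : ∑ i, feeCutoff D v β Q i ≤ 4 / (1 - b) * R := by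
    have := sum_feeCutoff_le D hv hR hb1 hβ₁ hQ
    rw [div_mul_eq_mul_div, le_div_iff₀ h1b]
    linarith
  have hrev := le_aspeRevenue D tb hv hQ (δ := medianFee D v Q τ)
    (fun i A => median_nonneg _ _)
    (half_le_measureReal_aspeAccepts D hv Q τ fun _ _ => rfl)
    (e := fun i j => X.interimExpectation D i j (netGain v γ (Q j) (τ i) i j))
    (fun i j => X.interimExpectation_nonneg D fun ti S _ => le_max_right _ _) (τ := τ)
    (fun i A => (sum_interimExpectation_netGain_le D X hv hγm (hβc i) (hγ i) hQ (hτ0 i) A).trans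
      (integral_maxSurplus_truncate_le D hv hQ hτ0 i A))
    (K := fun j => Q j - ∑ i, d i j)
    (fun j => sub_le_self _ (Finset.sum_nonneg fun i _ => hd0 i j))
    (itemPrice_sub_le_sum_netGain D X hv hγm hβc hγ hQ hQX τ)
  have hreal : 1 / 4 * ∑ j, Q j - 1 / 2 * ∑ i, (τ i - feeCutoff D v β Q i) ≤
      (1 / 4 * ∑ j, (Q j - ∑ i, d i j) - 1 / 2 * ∑ i, τ i) +
        (5 / (2 * (1 - b)) + (b + 1) / (2 * b * (1 - b))) * R := by
    rw [Finset.sum_sub_distrib, Finset.sum_sub_distrib, Finset.sum_comm (f := fun j i => d i j)]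
    have hR0 : 0 ≤ R := ENNReal.toReal_nonneg
    have e1 : (5 / (2 * (1 - b)) + (b + 1) / (2 * b * (1 - b))) * R =
        1 / 4 * ((2 / (b * (1 - b)) + 2 / (1 - b)) * R) + 1 / 2 * (4 / (1 - b) * R) +
          1 / (2 * (1 - b)) * R := by
      field_simp
      ring
    have h0 : 0 ≤ 1 / (2 * (1 - b)) * R := by positivity
    rw [e1]
    linarith
  refine (ENNReal.ofReal_le_ofReal hreal).trans (ENNReal.ofReal_add_le.trans
    (add_le_add hrev ?_))
  rw [ENNReal.ofReal_mul (by positivity), hRdef, ENNReal.ofReal_toReal hR]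

theorem aspeRevenue_medianFee_le (Q : Fin m → ℝ) (τ : Fin n → ℝ) :
    aspeRevenue D tb v Q (medianFee D v Q τ) ≤ aspeRevenueAtPrices D tb v Q :=
  le_iSup (fun δ : Fin n → Finset (Fin m) → ℝ≥0 => aspeRevenue D tb v Q fun i S => (δ i S : ℝ))
    fun i S => ⟨medianFee D v Q τ i S, median_nonneg _ _⟩

theorem aspeRevenueAtPrices_le_APostEnRev {Q : Fin m → ℝ} (hQ : ∀ j, 0 ≤ Q j) :
    aspeRevenueAtPrices D tb v Q ≤ APostEnRev D tb v :=
  le_iSup (fun p : Fin m → ℝ≥0 => aspeRevenueAtPrices D tb v fun j => (p j : ℝ))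
    fun j => ⟨Q j, hQ j⟩

end EntryFees

end Auction

theorem mainTheorem3 {n m : ℕ} {T : Fin n → Fin m → Type*} [∀ i j, MeasurableSpace (T i j)]
    (D : ∀ i j, Measure (T i j)) [∀ i j, IsProbabilityMeasure (D i j)]
    (v : Auction.Valuation T) (hv : Auction.SubadditiveOverItems v)
    (tb : Auction.TieBreaking n m)
    (X : Auction.AllocationRule T)
    (b : ℝ) (hb0 : 0 < b) (hb1 : b < 1)
    (β : Fin n → Fin m → ℝ) (hβ : ∀ i j, 0 ≤ β i j)
    (hβ₁ : ∀ i j, ∑ k ∈ Finset.univ.erase i, Auction.tailProb D v k j (β k j) ≤ b)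
    (hβ₂ : ∀ i j, ∫ ti, X.itemInterim D i j ti ∂(Auction.bidderDist D i)
      ≤ Auction.tailProb D v i j (β i j) / b)
    (c : Fin n → ℝ) (hc : ∀ i, c i = Auction.coreCutoff D v β i)
    (α : ℝ) (hα : 1 ≤ α)
    (γ : ∀ i : Fin n, Auction.BidderType T i → Finset (Fin m) → Fin m → ℝ)
    (hγ_meas : ∀ i S j, Measurable (fun ti => γ i ti S j))
    (hγ : ∀ i ti S, Auction.IsSupportingPrices α
      (Auction.truncate v i (fun j => β i j + c i) ti) S (γ i ti S))
    (Q : Fin m → ℝ) (hQ : ∀ j, Q j = Auction.itemPrice D X γ j)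
    (τ : Fin n → ℝ) (hτ : ∀ i, τ i = Auction.feeCutoff D v β Q i)
    (δ : Fin n → Finset (Fin m) → ℝ) (hδ : ∀ i S, δ i S = Auction.medianFee D v Q τ i S) :
    (∀ (i : Fin n) (t : Auction.Profile T),
      1 / 2 ≤ (Auction.bidderDist D i).real
        {ti | Auction.aspeAccepts v Q δ i ti (Auction.aspeAvailable tb v Q δ t i)}) ∧
    ENNReal.ofReal (1 / 4 * ∑ j, Q j) ≤
      Auction.APostEnRev D tb v +
        ENNReal.ofReal (5 / (2 * (1 - b)) + (b + 1) / (2 * b * (1 - b))) *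
          Auction.PostRev D tb v ∧
    ENNReal.ofReal (1 / 4 * ∑ j, Q j) ≤
      Auction.aspeRevenueAtPrices D tb v Q +
        ENNReal.ofReal (5 / (2 * (1 - b)) + (b + 1) / (2 * b * (1 - b))) *
          Auction.PostRev D tb v ∧
    ((∀ i, ∑ j, Auction.tailProb D v i j (max (β i j) (Q j + τ i)) ≤ 1 / 2) →
      ENNReal.ofReal (1 / 4 * ∑ j, Q j) ≤
        Auction.aspeRevenue D tb v Q δ +
          ENNReal.ofReal (5 / (2 * (1 - b)) + (b + 1) / (2 * b * (1 - b))) *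
            Auction.PostRev D tb v) := by
  have hQ0 : ∀ j, 0 ≤ Q j := fun j => by
    rw [hQ]; exact Auction.itemPrice_nonneg D X hγ j
  have hprices : ENNReal.ofReal (1 / 4 * ∑ j, Q j) ≤
      Auction.aspeRevenueAtPrices D tb v Q +
        ENNReal.ofReal (5 / (2 * (1 - b)) + (b + 1) / (2 * b * (1 - b))) *
          Auction.PostRev D tb v := by
    by_cases htop : Auction.aspeRevenueAtPrices D tb v Q +
        ENNReal.ofReal (5 / (2 * (1 - b)) + (b + 1) / (2 * b * (1 - b))) *
          Auction.PostRev D tb v = ∞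
    · rw [htop]; exact le_top
    rw [ENNReal.ofReal_le_iff_le_toReal htop]
    refine le_of_forall_pos_le_add fun ε hε => ?_
    -- with atoms the tail condition may fail at the cutoffs, but it holds just above them
    set ε' : ℝ := 2 * ε / (n + 1) with hε'
    have hε'0 : 0 < ε' := by positivity
    have h := (Auction.le_aspeRevenue_medianFee D tb X hv hb0 hb1 hβ hβ₁ hβ₂ hc hγ_meas hγ hQ
      (τ := fun i => τ i + ε') (fun i => by rw [hτ i]; linarith)
      (fun i => Auction.sum_tailProb_le_half_of_feeCutoff_lt D hv β hQ0 i
        (by rw [hτ i]; linarith))).trans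
      (add_le_add_left (Auction.aspeRevenue_medianFee_le D tb Q _) _)
    rw [ENNReal.ofReal_le_iff_le_toReal htop] at h
    have e : 1 / 2 * ∑ i, (τ i + ε' - Auction.feeCutoff D v β Q i) ≤ ε := by
      simp only [hτ, add_sub_cancel_left, Finset.sum_const, Finset.card_univ, Fintype.card_fin,
        nsmul_eq_mul, hε']
      have : 1 / 2 * (n * (2 * ε / (n + 1))) = ε * (n / (n + 1) : ℝ) := by field_simp
      rw [this]
      exact mul_le_of_le_one_right hε.le ((div_le_one (by positivity)).2 (by linarith))
    linarith
  refine ⟨fun i t => Auction.half_le_measureReal_aspeAccepts D hv Q τ hδ i _,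
    hprices.trans (add_le_add_left (Auction.aspeRevenueAtPrices_le_APostEnRev D tb hQ0) _),
    hprices, fun hs => ?_⟩
  have h := Auction.le_aspeRevenue_medianFee D tb X hv hb0 hb1 hβ hβ₁ hβ₂ hc hγ_meas hγ hQ
    (τ := τ) (fun i => (hτ i).ge) hs
  have hδ' : δ = Auction.medianFee D v Q τ := funext fun i => funext fun S => hδ i S
  simpa [hδ', hτ] using h
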